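/- Let $p$ be a prime number and let $G$ be a nontrivial pro-$p$ group (of arbitrary, possibly infinite, rank). For a profinite group $U$ let $U^{ab}$ be the quotient of $U$ by the closure of its commutator subgroup. For an open subgroup $V$ of $U$ let $\mathrm{Ver}: U^{ab}\to V^{ab}$ be the transfer homomorphism, and let $$\mathcal V: U^{ab}\otimes \mathbb Q_p/\mathbb Z_p\to V^{ab}\otimes \mathbb Q_p/\mathbb Z_p$$ be the homomorphism with $\mathcal V(x\otimes y)=\mathrm{Ver}(x)\otimes y$. A profinite $\mathbb Z_p$-module is called $\mathbb Z_p$-free if it is topologically isomorphic to a product $\mathbb Z_p^I$ for some set $I$ (for finitely generated modules this is the usual freeness). Then the following are equivalent: (i) $G$ is a free pro-$p$ group, i.e. free pro-$p$ on some family of elements converging to $1$. (ii) For every open normal subgroup $U$ of $G$ the module $U^{ab}$ is $\mathbb Z_p$-free, and for every open subgroup $U$ of $G$ and every open normal subgroup $V$ of $U$, the homomorphism $\mathcal V: U^{ab}\otimes \mathbb Q_p/\mathbb Z_p\to V^{ab}\otimes \mathbb Q_p/\mathbb Z_p$ is injective. -/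

import Mathlib

open Filter Topology
open scoped TensorProduct

universe u

/-- A profinite group `G` is *pro-`p`* if `G ⧸ U` is a `p`-group for every open normal
subgroup `U`. -/
def IsProP (p : ℕ) (G : Type u) [Group G] [TopologicalSpace G] [IsTopologicalGroup G]
    [CompactSpace G] [TotallyDisconnectedSpace G] : Prop :=
  ∀ U : OpenNormalSubgroup G, IsPGroup p (G ⧸ U.toSubgroup)

/-- `G` is *free pro-`p`* on the family `ι : X → G`: the family converges to `1` (every
neighbourhood of `1` contains `ι x` for all but finitely many `x`), and every family `φ : X → H`
converging to `1` in a pro-`p` group `H` extends uniquely to a continuous homomorphism `G → H`. -/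
def IsFreeProPOn (p : ℕ) {G : Type u} [Group G] [TopologicalSpace G] {X : Type u}
    (ι : X → G) : Prop :=
  Tendsto ι cofinite (𝓝 1) ∧
    ∀ (H : Type u) [Group H] [TopologicalSpace H] [IsTopologicalGroup H] [CompactSpace H]
      [TotallyDisconnectedSpace H], IsProP p H →
      ∀ φ : X → H, Tendsto φ cofinite (𝓝 1) → ∃! f : G →ₜ* H, ∀ x, f (ι x) = φ x

/-- `G` is a *free pro-`p` group* (of arbitrary, possibly infinite, rank). It is meant for
groups `G` which are already known to be pro-`p`. -/
def IsFreeProP (p : ℕ) (G : Type u) [Group G] [TopologicalSpace G] : Prop :=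
  ∃ (X : Type u) (ι : X → G), IsFreeProPOn p ι

/-- A topological abelian group (written multiplicatively) is *`ℤ_p`-free*, as a profinite
`ℤ_p`-module, if it is topologically isomorphic to a product `ℤ_p ^ I`, the free profinite
`ℤ_p`-module on a set `I` converging to `0`. (A continuous homomorphism between profinite
`ℤ_p`-modules is automatically `ℤ_p`-linear. When the module is finitely generated, `I` is finite
and this is freeness in the algebraic sense.) -/
def IsZpFree (p : ℕ) [Fact p.Prime] (A : Type u) [CommGroup A] [TopologicalSpace A] : Prop :=
  ∃ I : Type u, Nonempty (Additive A ≃ₜ+ (I → ℤ_[p]))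

/-- The discrete group `ℚ_p / ℤ_p`. -/
abbrev QpModZp (p : ℕ) [Fact p.Prime] : Type := ℚ_[p] ⧸ (PadicInt.subring p).toAddSubgroup

section transfer

variable {G : Type u} [Group G] [TopologicalSpace G] [IsTopologicalGroup G]

instance OpenSubgroup.instCompactSpaceToSubgroup [CompactSpace G] (U : OpenSubgroup G) :
    CompactSpace U.toSubgroup :=
  isCompact_iff_compactSpace.mp U.isClosed.isCompact

instance OpenSubgroup.instFiniteIndexToSubgroup [CompactSpace G] (U : OpenSubgroup G) :
    U.toSubgroup.FiniteIndex :=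
  Subgroup.finiteIndex_of_finite_quotient

/-- The transfer of a continuous homomorphism on an open subgroup is continuous. -/
theorem continuous_transfer {A : Type u} [CommGroup A] [TopologicalSpace A] [ContinuousMul A]
    (V : OpenSubgroup G) [V.toSubgroup.FiniteIndex] (φ : V.toSubgroup →* A) (hφ : Continuous φ) :
    Continuous (MonoidHom.transfer φ) := by
  let T : V.toSubgroup.LeftTransversal := default
  let _ := V.toSubgroup.fintypeQuotientOfFiniteIndex
  have h : (MonoidHom.transfer φ : G → A) =
      fun g => Subgroup.leftTransversals.diff φ T (g • T) :=
    funext fun g => MonoidHom.transfer_def φ T g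
  rw [h]
  unfold Subgroup.leftTransversals.diff
  refine continuous_finsetProd _ fun q _ => hφ.comp (Continuous.subtype_mk ?_ _)
  simp only [Subgroup.smul_apply_eq_smul_apply_inv_smul, smul_eq_mul]
  refine continuous_const.mul (continuous_id.mul ?_)
  have hT : Continuous fun r : G ⧸ V.toSubgroup => (T.2.leftQuotientEquiv r : G) :=
    continuous_of_discreteTopology
  refine hT.comp ?_
  induction q using QuotientGroup.induction_on with
  | H x => exact continuous_quotient_mk'.comp (continuous_inv.mul continuous_const)

/-- The transfer `Ver : G^ab → V^ab` for an open subgroup `V` of a compact group `G`, where `G^ab`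
is the quotient of `G` by the closure of its commutator subgroup. It is induced by the transfer
`G → V^ab` of the projection `V → V^ab`. -/
noncomputable def ver [CompactSpace G] (V : OpenSubgroup G) :
    TopologicalAbelianization G →* TopologicalAbelianization V.toSubgroup :=
  QuotientGroup.lift _
    (MonoidHom.transfer (QuotientGroup.mk' (commutator V.toSubgroup).topologicalClosure))
    (by
      have hc : Continuous (MonoidHom.transfer
          (QuotientGroup.mk' (commutator V.toSubgroup).topologicalClosure)) :=
        continuous_transfer V _ continuous_quotient_mk'
      have : IsClosed ((commutator V.toSubgroup).topologicalClosure : Set V.toSubgroup) :=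
        Subgroup.isClosed_topologicalClosure _
      have hcl : IsClosed ((MonoidHom.transfer
          (QuotientGroup.mk' (commutator V.toSubgroup).topologicalClosure)).ker : Set G) :=
        isClosed_singleton.preimage hc
      exact fun x hx => Subgroup.topologicalClosure_minimal _
        (Abelianization.commutator_subset_ker _) hcl hx)

/-- The map `𝒱 : G^ab ⊗ ℚ_p/ℤ_p → V^ab ⊗ ℚ_p/ℤ_p`, `x ⊗ y ↦ Ver x ⊗ y`.

The tensor products are over `ℤ`. For a `ℤ_p`-module `M` this is the same group as the tensor
product over `ℤ_p`: if `a ∈ ℤ_p`, `y ∈ ℚ_p/ℤ_p` and `p ^ n • y = 0`, write `a = k + p ^ n b` with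
`k ∈ ℤ`; then `a x ⊗ y = k x ⊗ y + b x ⊗ p ^ n y = x ⊗ k y = x ⊗ a y`. -/
noncomputable def verTensor (p : ℕ) [Fact p.Prime] [CompactSpace G] (V : OpenSubgroup G) :
    Additive (TopologicalAbelianization G) ⊗[ℤ] QpModZp p →ₗ[ℤ]
      Additive (TopologicalAbelianization V.toSubgroup) ⊗[ℤ] QpModZp p :=
  (MonoidHom.toAdditive (ver V)).toIntLinearMap.rTensor (QpModZp p)

end transfer

/-!
Freeness of a pro-`p` group `G` is compared with the conditions on abelianizations and transfers
through the vanishing of `H²(G, 𝔽_p)`, in the form `CentralExtensionsSplit`: every extension of `G`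
by a central subgroup of order `p` splits. No cohomology is set up; classes are replaced by
characters, the continuous homomorphisms to `ℚ_p / ℤ_p`, which extend well because this group is
injective.

*The conditions on `U^ab` and `𝒱` imply `H² = 0`* (`centralExtensionsSplit_of_isZpFree`). If `U^ab`
is `ℤ_p`-free, it is torsion free, so characters of `U` have `p`-th roots, and injectivity of `𝒱`
means injectivity of `Ver` modulo `p`, or dually surjectivity of the transfer on `p`-torsion
characters. A central extension splits over some open normal subgroup of `G`, and there is a chain
of normal subgroups from it to `G` with steps of index `p`. The step from `V` to `U` is
`exists_splitting_of_normal_subgroup`: if `σ` generates `U / V` and `ψ` is a splitting over `V`,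
then `ψ / ψ ^ σ` is a character of `V` with trivial transfer, it has a `p`-th root `μ` with trivial
transfer, and the identity `p = N + (1 - σ) g` in `ℤ[U / V]`, where `N` is the norm and `g` some
element, exhibits `μ ^ p` as a coboundary. The modified splitting is invariant, extends to `U`, and
is made `p`-torsion by dividing by a root.

*`H² = 0` implies freeness* (`isFreeProP_of_centralExtensionsSplit`). A basis of `H¹(G, 𝔽_p)`
yields a generating family `s` converging to `1` with dual characters (`IsProP.exists_generators`,
which rests on lifting convergent families along surjections, `exists_lift_tendsto_one`). For `φ :
X → H` the closed subgroup of `G × H` generated by all `(s x, φ x)` is the graph of the extension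
of `φ`: were its projection to `G` not injective, a central extension of order `p` would split off,
although it is generated by lifts of `s`, in contradiction to the dual characters.

*Freeness implies the conditions* (`IsFreeProP.isZpFree_and_injective`). A free pro-`p` group lifts
along surjections of finite `p`-groups. This property passes to open subgroups `U` by an induction
of lifting problems with wreath products (`LiftsAlongFiniteSurjections.openSubgroup`), and it
implies `H² = 0`; hence every `U` is free and `U^ab` is a product of copies of `ℤ_p`. The lifting
property for `C ≀ (U / V) → C × U / V` shows that every homomorphism from `U` to a finite
commutative `p`-group `C` is a transfer from `V`. With `C = 𝔽_p` this gives injectivity of `Ver`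
modulo `p`, and then of `𝒱`, as `U^ab` and `V^ab` are torsion free.
-/

/-! ### The Prüfer group as a target of characters -/

/-- The discrete group `ℚ_p / ℤ_p`, written multiplicatively; characters take values in it. -/
abbrev PruferGroup (p : ℕ) [Fact p.Prime] : Type := Multiplicative (QpModZp p)

section Prufer

variable (p : ℕ) [Fact p.Prime]

instance QpModZp.instDiscreteTopology : DiscreteTopology (QpModZp p) := by
  refine QuotientAddGroup.discreteTopology ?_
  have : ((PadicInt.subring p).toAddSubgroup : Set ℚ_[p]) = Metric.closedBall 0 1 := by
    ext x
    simp [PadicInt.subring]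
  rw [this]
  exact IsUltrametricDist.isOpen_closedBall _ one_ne_zero

instance PruferGroup.instDiscreteTopology : DiscreteTopology (PruferGroup p) :=
  inferInstanceAs (DiscreteTopology (QpModZp p))

theorem QpModZp.mk_eq_zero_iff {x : ℚ_[p]} :
    (QuotientAddGroup.mk x : QpModZp p) = 0 ↔ ‖x‖ ≤ 1 := by
  rw [QuotientAddGroup.eq_zero_iff]
  rfl

/-- `ℚ_p / ℤ_p` is divisible, hence an injective abelian group. -/
theorem PruferGroup.baer : Module.Baer ℤ (Additive (PruferGroup p)) := by
  let _ : DivisibleBy (QpModZp p) ℤ := divisibleByOfSMulRightSurj _ _ (by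
    intro n hn x
    obtain ⟨x, rfl⟩ := QuotientAddGroup.mk_surjective x
    refine ⟨QuotientAddGroup.mk ((n : ℚ_[p])⁻¹ * x), ?_⟩
    change n • (QuotientAddGroup.mk ((n : ℚ_[p])⁻¹ * x) : QpModZp p) = _
    rw [← QuotientAddGroup.mk_zsmul, zsmul_eq_mul, mul_inv_cancel_left₀ (by exact_mod_cast hn)])
  exact Module.Baer.of_divisible (QpModZp p)

/-- The class of `1 / p`, a generator of the `p`-torsion of `ℚ_p / ℤ_p`. -/
noncomputable def PruferGroup.zeta : PruferGroup p :=
  Multiplicative.ofAdd (QuotientAddGroup.mk ((p : ℚ_[p])⁻¹))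

theorem PruferGroup.zeta_pow : PruferGroup.zeta p ^ p = 1 := by
  change p • (QuotientAddGroup.mk ((p : ℚ_[p])⁻¹) : QpModZp p) = 0
  rw [← QuotientAddGroup.mk_nsmul, QpModZp.mk_eq_zero_iff, nsmul_eq_mul,
    mul_inv_cancel₀ (by exact_mod_cast (Fact.out : p.Prime).ne_zero)]
  simp

theorem PruferGroup.zeta_ne_one : PruferGroup.zeta p ≠ 1 := by
  change (QuotientAddGroup.mk ((p : ℚ_[p])⁻¹) : QpModZp p) ≠ 0
  rw [Ne, QpModZp.mk_eq_zero_iff, norm_inv, Padic.norm_p, inv_inv, not_le]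
  exact_mod_cast (Fact.out : p.Prime).one_lt

theorem PruferGroup.exists_zeta_pow {d : PruferGroup p} (hd : d ^ p = 1) :
    ∃ n : ℕ, PruferGroup.zeta p ^ n = d := by
  obtain ⟨x, hx⟩ := QuotientAddGroup.mk_surjective (Multiplicative.toAdd d)
  have hp : (p : ℚ_[p]) ≠ 0 := by exact_mod_cast (Fact.out : p.Prime).ne_zero
  have h1 : ‖(p : ℚ_[p]) * x‖ ≤ 1 := by
    have : p • (Multiplicative.toAdd d) = 0 := hd
    rw [← hx, ← QuotientAddGroup.mk_nsmul, QpModZp.mk_eq_zero_iff, nsmul_eq_mul] at this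
    exact this
  let y : ℤ_[p] := ⟨p * x, h1⟩
  refine ⟨PadicInt.zmodRepr y, ?_⟩
  have h2 : ‖y - PadicInt.zmodRepr y‖ < 1 := PadicInt.mem_nonunits.1
    ((IsLocalRing.mem_maximalIdeal _).1 (PadicInt.sub_zmodRepr_mem y))
  rw [PadicInt.norm_lt_one_iff_dvd] at h2
  obtain ⟨z, hz⟩ := h2
  change PadicInt.zmodRepr y • (QuotientAddGroup.mk ((p : ℚ_[p])⁻¹) : QpModZp p) =
    Multiplicative.toAdd d
  rw [← hx, ← QuotientAddGroup.mk_nsmul, ← sub_eq_zero, ← QuotientAddGroup.mk_sub,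
    QpModZp.mk_eq_zero_iff]
  have h3 : (p : ℚ_[p]) * x - (PadicInt.zmodRepr y : ℚ_[p]) = p * z := by
    have := congrArg (fun t : ℤ_[p] => (t : ℚ_[p])) hz
    simpa using this
  have h4 : PadicInt.zmodRepr y • (p : ℚ_[p])⁻¹ - x = -(z : ℚ_[p]) := by
    rw [nsmul_eq_mul]
    field_simp
    linear_combination -h3
  rw [h4, norm_neg]
  exact z.2

end Prufer

/-! ### Extension and descent of characters -/

theorem Module.Baer.exists_extension {D A B : Type*} [CommGroup D] [CommGroup A] [Group B]
    (hD : Module.Baer ℤ (Additive D)) (f : B →* A) (g : B →* D) (h : f.ker ≤ g.ker) :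
    ∃ F : A →* D, ∀ b, F (f b) = g b := by
  let g' : f.range →* D := (MonoidHom.liftOfSurjective f.rangeRestrict f.rangeRestrict_surjective)
    ⟨g, by rwa [MonoidHom.ker_rangeRestrict]⟩
  have hg' : ∀ b, g' (f.rangeRestrict b) = g b := fun b =>
    MonoidHom.liftOfRightInverse_comp_apply _ _ _ _ b
  obtain ⟨F, hF⟩ := hD.extension_property_addMonoidHom
    (MonoidHom.toAdditive f.range.subtype) (Subtype.val_injective) (MonoidHom.toAdditive g')
  refine ⟨MonoidHom.toAdditive.symm F, fun b => ?_⟩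
  rw [← hg' b]
  exact DFunLike.congr_fun hF (Additive.ofMul (f.rangeRestrict b))

theorem MonoidHom.continuous_of_isOpen_ker {A D : Type*} [Group A] [TopologicalSpace A]
    [IsTopologicalGroup A] [Group D] [TopologicalSpace D] (F : A →* D)
    (h : IsOpen (F.ker : Set A)) : Continuous F := by
  refine continuous_iff_continuousAt.2 fun a => ?_
  refine tendsto_nhds_of_eventually_eq ?_ |>.congr fun _ => rfl
  have h1 : (fun x => a⁻¹ * x) ⁻¹' (F.ker : Set A) ∈ 𝓝 a :=
    (h.preimage (continuous_const.mul continuous_id)).mem_nhds (by simp)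
  filter_upwards [h1] with x hx
  have : F (a⁻¹ * x) = 1 := hx
  rw [map_mul, map_inv, inv_mul_eq_one] at this
  exact this.symm

theorem MonoidHom.isOpen_ker {A D : Type*} [Group A] [TopologicalSpace A]
    [Group D] [TopologicalSpace D] [DiscreteTopology D] (F : A →* D)
    (h : Continuous F) : IsOpen (F.ker : Set A) :=
  (isOpen_discrete ({1} : Set D)).preimage h

/-- A discrete-valued character of a compact group that kills the kernel of a continuous
homomorphism `i` to a commutative group extends along `i`, if the target is injective. -/
theorem exists_continuous_extension {D A B : Type*} [CommGroup D] [TopologicalSpace D]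
    [DiscreteTopology D] [CommGroup A] [TopologicalSpace A] [IsTopologicalGroup A]
    [Group B] [TopologicalSpace B] [CompactSpace B] [T2Space A]
    (hD : Module.Baer ℤ (Additive D))
    (hA : ∀ O : Set A, IsOpen O → 1 ∈ O → ∃ W : OpenSubgroup A, (W : Set A) ⊆ O)
    (i : B →* A) (hi : Continuous i) (g : B →* D) (hg : Continuous g) (h : i.ker ≤ g.ker) :
    ∃ F : A →* D, Continuous F ∧ ∀ b, F (i b) = g b := by
  have hK : IsCompact (i '' (g.ker : Set B)ᶜ) :=
    ((g.isOpen_ker hg).isClosed_compl.isCompact).image hi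
  obtain ⟨W, hW⟩ := hA _ hK.isClosed.isOpen_compl (by
    rintro ⟨b, hb, hb1⟩
    exact hb (h hb1))
  obtain ⟨F, hF⟩ := hD.exists_extension ((QuotientGroup.mk' W.toSubgroup).comp i) g (by
    intro b hb
    have hb' : i b ∈ W.toSubgroup := by
      rwa [MonoidHom.mem_ker, MonoidHom.comp_apply, QuotientGroup.mk'_apply,
        QuotientGroup.eq_one_iff] at hb
    by_contra hbg
    exact hW hb' ⟨b, hbg, rfl⟩)
  refine ⟨F.comp (QuotientGroup.mk' W.toSubgroup), ?_, hF⟩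
  refine MonoidHom.continuous_of_isOpen_ker _ (Subgroup.isOpen_mono (H₁ := W.toSubgroup) ?_
    W.isOpen)
  intro x hx
  have : (QuotientGroup.mk' W.toSubgroup) x = 1 := by
    rwa [QuotientGroup.mk'_apply, QuotientGroup.eq_one_iff]
  rw [MonoidHom.mem_ker, MonoidHom.comp_apply, this, map_one]

theorem exists_continuous_descent {D E U : Type*} [Group D] [TopologicalSpace D]
    [Group E] [TopologicalSpace E] [CompactSpace E] [Group U] [TopologicalSpace U] [T2Space U]
    (π : E →* U) (hπ : Continuous π) (hs : Function.Surjective π) (g : E →* D)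
    (hg : Continuous g) (h : π.ker ≤ g.ker) : ∃ F : U →* D, Continuous F ∧ ∀ e, F (π e) = g e := by
  let F : U →* D := (MonoidHom.liftOfSurjective π hs) ⟨g, h⟩
  have hF : ∀ e, F (π e) = g e := fun b => MonoidHom.liftOfRightInverse_comp_apply _ _ _ _ b
  refine ⟨F, ?_, hF⟩
  have hq : IsQuotientMap π := hπ.isClosedMap.isQuotientMap hπ hs
  rw [hq.continuous_iff]
  exact hg.congr fun e => (hF e).symm

/-- A character of a normal subgroup `V` with cyclic quotient, invariant under conjugation by a
generator of the quotient, extends to the whole group: the group modulo the kernel of the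
character is commutative. -/
theorem exists_extension_of_invariant {D G : Type*} [CommGroup D] [TopologicalSpace D]
    [DiscreteTopology D] [Group G] [TopologicalSpace G] [IsTopologicalGroup G]
    (hD : Module.Baer ℤ (Additive D)) (V : Subgroup G) [V.Normal] (hV : IsOpen (V : Set G))
    (σ : G) (hσ : ∀ g : G, ∃ k : ℕ, (σ ^ k)⁻¹ * g ∈ V) (f : V →* D) (hf : Continuous f)
    (hinv : ∀ v v' : V, (v' : G) = σ⁻¹ * v * σ → f v' = f v) :
    ∃ F : G →* D, Continuous F ∧ ∀ v : V, F v = f v := by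
  let K : Subgroup G := f.ker.map V.subtype
  have hpow : ∀ (k : ℕ) (v v' : V), (v' : G) = (σ ^ k)⁻¹ * v * σ ^ k → f v' = f v := by
    intro k
    induction k with
    | zero => intro v v' h; congr 1; ext; simpa using h
    | succ k ih =>
      intro v v' h
      have hn : (σ ^ k)⁻¹ * v * σ ^ k ∈ V := by
        simpa using (inferInstance : V.Normal).conj_mem v v.2 (σ ^ k)⁻¹
      rw [hinv ⟨_, hn⟩ v' (by rw [h, pow_succ]; group), ih v ⟨_, hn⟩ rfl]
  have hinv' : ∀ (g : G) (v v' : V), (v' : G) = g⁻¹ * v * g → f v' = f v := by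
    intro g v v' h
    obtain ⟨k, hk⟩ := hσ g
    have hn : (σ ^ k)⁻¹ * v * σ ^ k ∈ V := by
      simpa using (inferInstance : V.Normal).conj_mem v v.2 (σ ^ k)⁻¹
    rw [← hpow k v ⟨_, hn⟩ rfl]
    have : v' = ⟨_, hk⟩⁻¹ * ⟨_, hn⟩ * ⟨_, hk⟩ := by
      ext
      simp only [h, Subgroup.coe_mul, Subgroup.coe_inv]
      group
    rw [this, map_mul, map_mul, map_inv, mul_comm, mul_inv_cancel_left]
  have hKn : K.Normal := by
    constructor
    rintro _ ⟨v, hv, rfl⟩ g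
    have hn : g * v * g⁻¹ ∈ V := (inferInstance : V.Normal).conj_mem v v.2 g
    refine ⟨⟨_, hn⟩, ?_, rfl⟩
    change f _ = 1
    rw [hinv' g⁻¹ v ⟨_, hn⟩ (by simp)]
    exact hv
  have hKo : IsOpen (K : Set G) := by
    have := hV.isOpenMap_subtype_val _ (f.isOpen_ker hf)
    exact this
  have hKV : K ≤ V := by
    rintro _ ⟨v, hv, rfl⟩
    exact v.2
  let q : G ⧸ K →* G ⧸ V := QuotientGroup.map K V (MonoidHom.id G) hKV
  have hcyc : IsCyclic (G ⧸ V) := by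
    refine ⟨⟨(QuotientGroup.mk σ), fun x => ?_⟩⟩
    obtain ⟨g, rfl⟩ := QuotientGroup.mk_surjective x
    obtain ⟨k, hk⟩ := hσ g
    refine ⟨k, ?_⟩
    simp only [zpow_natCast]
    rw [← QuotientGroup.mk_pow]
    exact QuotientGroup.eq.2 hk
  have hcomm : IsMulCommutative (G ⧸ K) := by
    refine MonoidHom.isMulCommutative_of_isCyclic_of_ker_le_center q ?_
    intro x hx
    obtain ⟨v, rfl⟩ := QuotientGroup.mk_surjective x
    have hv : v ∈ V := by
      have : (QuotientGroup.mk v : G ⧸ V) = 1 := hx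
      rwa [QuotientGroup.eq_one_iff] at this
    rw [Subgroup.mem_center_iff]
    intro y
    obtain ⟨g, rfl⟩ := QuotientGroup.mk_surjective y
    rw [← QuotientGroup.mk_mul, ← QuotientGroup.mk_mul, QuotientGroup.eq]
    have hn : g⁻¹ * v * g ∈ V := by simpa using (inferInstance : V.Normal).conj_mem v hv g⁻¹
    refine ⟨⟨v, hv⟩⁻¹ * ⟨_, hn⟩, ?_, ?_⟩
    · change f _ = 1
      rw [map_mul, map_inv, hinv' g ⟨v, hv⟩ ⟨_, hn⟩ rfl, inv_mul_cancel]
    · simp [mul_assoc]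
  let _ : CommGroup (G ⧸ K) := { (inferInstance : Group (G ⧸ K)) with mul_comm := hcomm.1.1 }
  obtain ⟨F, hF⟩ := hD.exists_extension ((QuotientGroup.mk' K).comp V.subtype) f (by
    intro v hv
    have : (v : G) ∈ K := by
      rwa [MonoidHom.mem_ker, MonoidHom.comp_apply, QuotientGroup.mk'_apply,
        QuotientGroup.eq_one_iff] at hv
    obtain ⟨w, hw, hwv⟩ := this
    have : w = v := Subtype.ext hwv
    exact this ▸ hw)
  refine ⟨F.comp (QuotientGroup.mk' K), ?_, hF⟩
  refine MonoidHom.continuous_of_isOpen_ker _ (Subgroup.isOpen_mono (H₁ := K) ?_ hKo)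
  intro x hx
  have : (QuotientGroup.mk' K) x = 1 := by
    rwa [QuotientGroup.mk'_apply, QuotientGroup.eq_one_iff]
  rw [MonoidHom.mem_ker, MonoidHom.comp_apply, this, map_one]

/-! ### The transfer -/

theorem MonoidHom.transfer_eq_prod_section {G A : Type*} [Group G] [CommGroup A] {H : Subgroup G}
    [H.FiniteIndex] [Fintype (G ⧸ H)] (φ : H →* A) (t : G ⧸ H → G)
    (ht : ∀ q, (QuotientGroup.mk (t q) : G ⧸ H) = q)
    (g : G) (hg : ∀ q : G ⧸ H, (t q)⁻¹ * (g * t (g⁻¹ • q)) ∈ H) :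
    MonoidHom.transfer φ g = ∏ q : G ⧸ H, φ ⟨(t q)⁻¹ * (g * t (g⁻¹ • q)), hg q⟩ := by
  classical
  let T : H.LeftTransversal := ⟨Set.range t, Subgroup.isComplement_range_left ht⟩
  have hT : ∀ q, (T.2.leftQuotientEquiv q : G) = t q := fun q =>
    Subgroup.IsComplement.leftQuotientEquiv_apply ht q
  rw [MonoidHom.transfer_def φ T g]
  unfold Subgroup.leftTransversals.diff
  refine Finset.prod_congr (by ext; simp) fun q _ => congrArg φ (Subtype.ext ?_)
  simp only [Subgroup.smul_apply_eq_smul_apply_inv_smul, smul_eq_mul, hT]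

theorem MonoidHom.transfer_section_mem {G : Type*} [Group G] {H : Subgroup G}
    (t : G ⧸ H → G) (ht : ∀ q, (QuotientGroup.mk (t q) : G ⧸ H) = q) (g : G) (q : G ⧸ H) :
    (t q)⁻¹ * (g * t (g⁻¹ • q)) ∈ H := by
  rw [← QuotientGroup.eq, ht, ← smul_eq_mul, ← MulAction.Quotient.smul_mk, ht, smul_inv_smul]

theorem MonoidHom.transfer_comp {G A B : Type*} [Group G] [CommGroup A] [CommGroup B]
    {H : Subgroup G} [H.FiniteIndex] (φ : H →* A) (f : A →* B) (g : G) :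
    MonoidHom.transfer (f.comp φ) g = f (MonoidHom.transfer φ g) := by
  let _ := H.fintypeQuotientOfFiniteIndex
  have ht := fun q : G ⧸ H => QuotientGroup.out_eq' q
  rw [MonoidHom.transfer_eq_prod_section _ _ ht g (MonoidHom.transfer_section_mem _ ht g),
    MonoidHom.transfer_eq_prod_section _ _ ht g (MonoidHom.transfer_section_mem _ ht g), map_prod]
  rfl

theorem MonoidHom.transfer_mul {G A : Type*} [Group G] [CommGroup A]
    {H : Subgroup G} [H.FiniteIndex] (φ ψ : H →* A) (g : G) :
    MonoidHom.transfer (φ * ψ) g = MonoidHom.transfer φ g * MonoidHom.transfer ψ g := by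
  let _ := H.fintypeQuotientOfFiniteIndex
  have ht := fun q : G ⧸ H => QuotientGroup.out_eq' q
  rw [MonoidHom.transfer_eq_prod_section _ _ ht g (MonoidHom.transfer_section_mem _ ht g),
    MonoidHom.transfer_eq_prod_section _ _ ht g (MonoidHom.transfer_section_mem _ ht g),
    MonoidHom.transfer_eq_prod_section _ _ ht g (MonoidHom.transfer_section_mem _ ht g),
    ← Finset.prod_mul_distrib]
  rfl

/-- The transfer does not see conjugation of a homomorphism by an element of the large group. -/
theorem MonoidHom.transfer_conj {G A : Type*} [Group G] [CommGroup A]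
    {H : Subgroup G} [H.Normal] [H.FiniteIndex] (φ ψ : H →* A) (σ : G)
    (h : ∀ v v' : H, (v' : G) = σ⁻¹ * v * σ → ψ v = φ v') (g : G) :
    MonoidHom.transfer ψ g = MonoidHom.transfer φ g := by
  let _ := H.fintypeQuotientOfFiniteIndex
  have ht := fun q : G ⧸ H => QuotientGroup.out_eq' q
  let t' : G ⧸ H → G := fun q => (q * (QuotientGroup.mk σ)⁻¹ : G ⧸ H).out * σ
  have ht' : ∀ q, (QuotientGroup.mk (t' q) : G ⧸ H) = q := fun q => by
    simp only [t', QuotientGroup.mk_mul]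
    rw [QuotientGroup.out_eq', inv_mul_cancel_right]
  rw [MonoidHom.transfer_eq_prod_section _ _ ht g (MonoidHom.transfer_section_mem _ ht g),
    MonoidHom.transfer_eq_prod_section _ _ ht' g (MonoidHom.transfer_section_mem _ ht' g)]
  refine Fintype.prod_equiv (Equiv.mulRight (QuotientGroup.mk σ : G ⧸ H)) _ _ fun q => ?_
  refine h _ _ ?_
  have h1 : (g⁻¹ • (q * QuotientGroup.mk σ : G ⧸ H)) * (QuotientGroup.mk σ)⁻¹ = g⁻¹ • q := by
    obtain ⟨x, rfl⟩ := QuotientGroup.mk_surjective q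
    rw [← QuotientGroup.mk_mul, MulAction.Quotient.smul_mk, MulAction.Quotient.smul_mk,
      ← QuotientGroup.mk_inv, ← QuotientGroup.mk_mul]
    congr 1
    simp [mul_assoc]
  simp only [t', Equiv.coe_mulRight, h1, mul_inv_cancel_right]
  group

/-! ### Pro-`p` groups -/

section ProP

variable {p : ℕ} {G : Type u} [Group G] [TopologicalSpace G] [IsTopologicalGroup G]
  [CompactSpace G] [TotallyDisconnectedSpace G]

theorem isProP_iff_tendsto :
    IsProP p G ↔ ∀ g : G, Tendsto (fun n : ℕ => g ^ p ^ n) atTop (𝓝 1) := by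
  constructor
  · intro h g
    rw [tendsto_def]
    intro O hO
    obtain ⟨O', hO', hO1, hO2⟩ := mem_nhds_iff.1 hO
    obtain ⟨W, hW⟩ := ProfiniteGrp.exist_openNormalSubgroup_sub_open_nhds_of_one hO1 hO2
    obtain ⟨k, hk⟩ := h W (QuotientGroup.mk g)
    rw [← QuotientGroup.mk_pow, QuotientGroup.eq_one_iff] at hk
    filter_upwards [eventually_ge_atTop k] with n hn
    refine hO' (hW ?_)
    obtain ⟨m, rfl⟩ := Nat.exists_eq_add_of_le hn
    change g ^ p ^ (k + m) ∈ W.toSubgroup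
    rw [pow_add, pow_mul]
    exact Subgroup.pow_mem _ hk _
  · intro h W x
    obtain ⟨g, rfl⟩ := QuotientGroup.mk_surjective x
    obtain ⟨n, hn⟩ := ((h g).eventually W.toOpenSubgroup.mem_nhds_one).exists
    refine ⟨n, ?_⟩
    rw [← QuotientGroup.mk_pow, QuotientGroup.eq_one_iff]
    exact hn

theorem IsProP.of_isInducing {H : Type u} [Group H] [TopologicalSpace H]
    [IsTopologicalGroup H] [CompactSpace H] [TotallyDisconnectedSpace H] (h : IsProP p G)
    (f : H →* G) (hf : IsInducing f) : IsProP p H := by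
  rw [isProP_iff_tendsto] at h ⊢
  intro x
  rw [hf.tendsto_nhds_iff, map_one]
  exact (h (f x)).congr fun n => (map_pow f x _).symm

theorem IsProP.of_surjective {H : Type u} [Group H] [TopologicalSpace H]
    [IsTopologicalGroup H] [CompactSpace H] [TotallyDisconnectedSpace H] (h : IsProP p G)
    (f : G →* H) (hf : Continuous f) (hs : Function.Surjective f) : IsProP p H := by
  rw [isProP_iff_tendsto] at h ⊢
  intro x
  obtain ⟨g, rfl⟩ := hs x
  have := (hf.tendsto 1).comp (h g)
  rw [map_one] at this
  exact this.congr fun n => (map_pow f g _)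

theorem IsProP.prod {H : Type u} [Group H] [TopologicalSpace H]
    [IsTopologicalGroup H] [CompactSpace H] [TotallyDisconnectedSpace H] (h : IsProP p G)
    (h' : IsProP p H) : IsProP p (G × H) := by
  rw [isProP_iff_tendsto] at h h' ⊢
  rintro ⟨x, y⟩
  exact (h x).prodMk_nhds (h' y)

theorem isProP_of_isPGroup [DiscreteTopology G] (h : IsPGroup p G) : IsProP p G := by
  intro U
  exact h.to_quotient _

theorem IsProP.isPGroup [DiscreteTopology G] (h : IsProP p G) : IsPGroup p G := by
  intro g
  obtain ⟨n, hn⟩ := ((isProP_iff_tendsto.1 h g).eventually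
    ((isOpen_discrete {(1 : G)}).mem_nhds rfl)).exists
  exact ⟨n, hn⟩

end ProP

/-! ### Finite `p`-groups and finite subgroups -/

theorem IsPGroup.dvd_natCard {p : ℕ} {P : Type*} [Group P] [Finite P] [Nontrivial P]
    [Fact p.Prime] (hP : IsPGroup p P) : p ∣ Nat.card P := by
  obtain ⟨n, hn, h⟩ := hP.nontrivial_iff_card.1 inferInstance
  exact h ▸ dvd_pow_self p hn.ne'

theorem IsPGroup.exists_mem_center_orderOf_eq {p : ℕ} {P : Type*} [Group P] [Finite P]
    [Nontrivial P] [Fact p.Prime] (hP : IsPGroup p P) :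
    ∃ z ∈ Subgroup.center P, orderOf z = p := by
  have : Nontrivial (Subgroup.center P) := hP.center_nontrivial
  obtain ⟨⟨z, hzc⟩, hz⟩ :=
    exists_prime_orderOf_dvd_card' p (hP.to_subgroup (Subgroup.center _)).dvd_natCard
  exact ⟨z, hzc, by rw [← hz, Subgroup.orderOf_mk]⟩

theorem Subgroup.normal_zpowers_of_mem_center {P : Type*} [Group P] {z : P}
    (hz : z ∈ Subgroup.center P) : (Subgroup.zpowers z).Normal := by
  refine ⟨fun x hx g => ?_⟩
  have hx' : x ∈ Subgroup.center P := (Subgroup.zpowers_le.2 hz) hx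
  rwa [Subgroup.mem_center_iff.1 hx' g, mul_inv_cancel_right]

theorem Subgroup.exists_openNormalSubgroup_disjoint {E : Type*} [Group E] [TopologicalSpace E]
    [IsTopologicalGroup E] [CompactSpace E] [TotallyDisconnectedSpace E] (K : Subgroup E)
    [Finite K] : ∃ W : OpenNormalSubgroup E, ∀ w ∈ W.toSubgroup, w ∈ K → w = 1 := by
  have hf : ((K : Set E) \ {1}).Finite := (Set.toFinite (K : Set E)).sdiff
  obtain ⟨W, hW⟩ := ProfiniteGrp.exist_openNormalSubgroup_sub_open_nhds_of_one
    hf.isClosed.isOpen_compl (by simp)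
  refine ⟨W, fun w hw h => ?_⟩
  by_contra h1
  exact hW hw ⟨h, h1⟩

/-! ### Splitting of central extensions, divisible characters, surjective transfers -/

/-- Every extension of `G` by a central subgroup of order `p` splits, in the category of
pro-`p` groups. A splitting is encoded as a `p`-torsion character of the extension that is
nontrivial on the central subgroup; the kernel of this character is a complement.
This expresses that `H²(G, 𝔽_p) = 0`. -/
def CentralExtensionsSplit (p : ℕ) [Fact p.Prime] (G : Type u) [Group G]
    [TopologicalSpace G] : Prop :=
  ∀ (E : Type u) [Group E] [TopologicalSpace E] [IsTopologicalGroup E] [CompactSpace E]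
    [TotallyDisconnectedSpace E], IsProP p E → ∀ π : E →* G, Continuous π →
    Function.Surjective π → π.ker ≤ Subgroup.center E → Nat.card π.ker = p →
    ∃ ψ : E →* PruferGroup p, Continuous ψ ∧ (∀ e, ψ e ^ p = 1) ∧ ∃ z ∈ π.ker, ψ z ≠ 1

/-- The group of characters `G → ℚ_p / ℤ_p` is `p`-divisible. -/
def CharactersDivisible (p : ℕ) [Fact p.Prime] (G : Type u) [Group G]
    [TopologicalSpace G] : Prop :=
  ∀ χ : G →* PruferGroup p, Continuous χ →
    ∃ μ : G →* PruferGroup p, Continuous μ ∧ ∀ g, μ g ^ p = χ g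

/-- The transfer from characters of order dividing `p` of `V` to those of `G` is surjective. -/
def TransferSurjective (p : ℕ) [Fact p.Prime] {G : Type u} [Group G]
    [TopologicalSpace G] (V : Subgroup G) [V.FiniteIndex] : Prop :=
  ∀ τ : G →* PruferGroup p, Continuous τ → (∀ g, τ g ^ p = 1) →
    ∃ μ : V →* PruferGroup p, Continuous μ ∧ (∀ v, μ v ^ p = 1) ∧
      ∀ g, MonoidHom.transfer μ g = τ g

/-! ### Characters and the topological abelianization -/

theorem TopologicalAbelianization.exists_lift {G : Type u} [Group G] [TopologicalSpace G]
    [IsTopologicalGroup G] {D : Type*} [CommGroup D] [TopologicalSpace D] [T1Space D]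
    (χ : G →* D) (hχ : Continuous χ) :
    ∃ χ' : TopologicalAbelianization G →* D, Continuous χ' ∧ ∀ g : G, χ' g = χ g := by
  have hcl : IsClosed (χ.ker : Set G) := (isClosed_singleton (x := (1 : D))).preimage hχ
  let χ' : TopologicalAbelianization G →* D := QuotientGroup.lift _ χ fun x hx =>
    Subgroup.topologicalClosure_minimal _ (Abelianization.commutator_subset_ker _) hcl hx
  refine ⟨χ', ?_, fun g => rfl⟩
  exact hχ.quotient_lift _

section

variable {G : Type u} [Group G] [TopologicalSpace G] [IsTopologicalGroup G] [CompactSpace G]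

theorem ver_mk (V : OpenSubgroup G) (g : G) :
    ver V (QuotientGroup.mk g) = MonoidHom.transfer
      (QuotientGroup.mk' (commutator V.toSubgroup).topologicalClosure) g := rfl

theorem continuous_ver (V : OpenSubgroup G) : Continuous (ver V) :=
  (continuous_transfer V _ continuous_quotient_mk').quotient_lift _

/-- Unlike in `continuous_transfer`, the target may live in any universe. -/
theorem continuous_transfer_character {D : Type*} [CommGroup D] [TopologicalSpace D] [T1Space D]
    (V : OpenSubgroup G) (χ : V.toSubgroup →* D) (hχ : Continuous χ) :
    Continuous (MonoidHom.transfer χ) := by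
  obtain ⟨χ', hχ', h⟩ := TopologicalAbelianization.exists_lift χ hχ
  have h1 : χ = χ'.comp (QuotientGroup.mk' (commutator V.toSubgroup).topologicalClosure) := by
    ext v
    exact (h v).symm
  have h2 : (MonoidHom.transfer χ : G → D) = fun g => χ' (ver V (QuotientGroup.mk g)) := by
    ext g
    rw [ver_mk, ← MonoidHom.transfer_comp, ← h1]
  rw [h2]
  exact hχ'.comp ((continuous_ver V).comp continuous_quotient_mk')

theorem TopologicalAbelianization.exists_openSubgroup_subset [TotallyDisconnectedSpace G]
    (O : Set (TopologicalAbelianization G)) (hO : IsOpen O) (h1 : 1 ∈ O) :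
    ∃ W : OpenSubgroup (TopologicalAbelianization G), (W : Set _) ⊆ O := by
  obtain ⟨N, hN⟩ := ProfiniteGrp.exist_openNormalSubgroup_sub_open_nhds_of_one
    (hO.preimage (continuous_quotient_mk' (s := QuotientGroup.leftRel _))) h1
  refine ⟨⟨N.toSubgroup.map (QuotientGroup.mk' _), ?_⟩, ?_⟩
  · exact QuotientGroup.isOpenMap_coe _ N.isOpen'
  · rintro _ ⟨x, hx, rfl⟩
    exact hN hx

instance TopologicalAbelianization.instT3Space {G : Type u} [Group G] [TopologicalSpace G]
    [IsTopologicalGroup G] : T3Space (TopologicalAbelianization G) := by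
  have : IsClosed ((commutator G).topologicalClosure : Set G) :=
    Subgroup.isClosed_topologicalClosure _
  infer_instance

theorem charactersDivisible_of_torsionFree [TotallyDisconnectedSpace G] (p : ℕ) [Fact p.Prime]
    (h : ∀ x : TopologicalAbelianization G, x ^ p = 1 → x = 1) : CharactersDivisible p G := by
  intro χ hχ
  obtain ⟨χ', hχ', hχχ'⟩ := TopologicalAbelianization.exists_lift χ hχ
  obtain ⟨F, hF, hF'⟩ := exists_continuous_extension (PruferGroup.baer p)
    (TopologicalAbelianization.exists_openSubgroup_subset (G := G))
    (powMonoidHom p) (continuous_pow p) χ' hχ' (fun x hx => by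
      rw [h x hx]
      exact map_one _)
  refine ⟨F.comp (QuotientGroup.mk' _), hF.comp continuous_quotient_mk', fun g => ?_⟩
  rw [← hχχ', ← hF', powMonoidHom_apply, map_pow]
  rfl

/-- If `Ver` is injective modulo `p`, then, dually, the transfer of `p`-torsion characters is
surjective. -/
theorem transferSurjective_of_ver [TotallyDisconnectedSpace G] (p : ℕ) [Fact p.Prime]
    (V : OpenSubgroup G) (h : ∀ x y, ver V x = y ^ p → ∃ x', x = x' ^ p) :
    TransferSurjective p V.toSubgroup := by
  intro τ hτ hτp
  have : TotallyDisconnectedSpace V.toSubgroup := inferInstance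
  obtain ⟨τ', hτ', hττ'⟩ := TopologicalAbelianization.exists_lift τ hτ
  obtain ⟨F, hF, hF'⟩ := exists_continuous_extension (PruferGroup.baer p)
    (TopologicalAbelianization.exists_openSubgroup_subset (G := V.toSubgroup))
    ((ver V).coprod (powMonoidHom p)) (by
      have h1 : Continuous fun x : TopologicalAbelianization G ×
          TopologicalAbelianization V.toSubgroup => ver V x.1 * x.2 ^ p :=
        ((continuous_ver V).comp continuous_fst).mul (continuous_snd.pow p)
      exact h1)
    (τ'.comp (MonoidHom.fst _ _)) (hτ'.comp continuous_fst) (by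
      rintro ⟨x, y⟩ hx
      have h1 : ver V x * y ^ p = 1 := hx
      obtain ⟨x', rfl⟩ := h x y⁻¹ (by rw [inv_pow]; exact eq_inv_of_mul_eq_one_left h1)
      change τ' (x' ^ p) = 1
      obtain ⟨g, rfl⟩ := QuotientGroup.mk_surjective x'
      rw [map_pow, hττ', hτp])
  have hF1 : ∀ x, F (ver V x) = τ' x := fun x => by
    simpa using hF' (x, 1)
  have hF2 : ∀ y, F y ^ p = 1 := fun y => by
    simpa using hF' (1, y)
  refine ⟨F.comp (QuotientGroup.mk' _), hF.comp continuous_quotient_mk', fun v => hF2 _,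
    fun g => ?_⟩
  rw [MonoidHom.transfer_comp, ← ver_mk, hF1, hττ']

end

/-! ### Splitting central extensions step by step -/

theorem MonoidHom.transfer_comap {G E A : Type*} [Group G] [Group E] [CommGroup A]
    (V : Subgroup G) [V.Normal] [V.FiniteIndex] (π : E →* G) (hs : Function.Surjective π)
    [(V.comap π).FiniteIndex] (χ : V →* A) (e : E) :
    MonoidHom.transfer (χ.comp (π.subgroupComap V)) e = MonoidHom.transfer χ (π e) := by
  let _ := V.fintypeQuotientOfFiniteIndex
  let _ := (V.comap π).fintypeQuotientOfFiniteIndex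
  let q : E ⧸ V.comap π →* G ⧸ V := QuotientGroup.map (V.comap π) V π le_rfl
  have hq : Function.Bijective q := by
    constructor
    · rw [injective_iff_map_eq_one]
      intro x hx
      obtain ⟨e, rfl⟩ := QuotientGroup.mk_surjective x
      have : (QuotientGroup.mk (π e) : G ⧸ V) = 1 := hx
      rw [QuotientGroup.eq_one_iff] at this ⊢
      exact this
    · intro x
      obtain ⟨g, rfl⟩ := QuotientGroup.mk_surjective x
      obtain ⟨e, rfl⟩ := hs g
      exact ⟨QuotientGroup.mk e, rfl⟩
  let Q := Equiv.ofBijective q hq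
  have ht := fun q : E ⧸ V.comap π => QuotientGroup.out_eq' q
  let t' : G ⧸ V → G := fun x => π (Q.symm x).out
  have hQ : ∀ e : E, Q (QuotientGroup.mk e) = QuotientGroup.mk (π e) := fun e => rfl
  have ht' : ∀ x, (QuotientGroup.mk (t' x) : G ⧸ V) = x := fun x => by
    rw [← hQ, QuotientGroup.out_eq', Equiv.apply_symm_apply]
  rw [MonoidHom.transfer_eq_prod_section _ _ ht e (MonoidHom.transfer_section_mem _ ht e),
    MonoidHom.transfer_eq_prod_section _ _ ht' (π e) (MonoidHom.transfer_section_mem _ ht' (π e))]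
  refine Fintype.prod_equiv Q _ _ fun x => ?_
  rw [MonoidHom.comp_apply]
  refine congrArg χ (Subtype.ext ?_)
  have h1 : Q.symm ((π e)⁻¹ • Q x) = e⁻¹ • x := by
    rw [Equiv.symm_apply_eq]
    obtain ⟨y, rfl⟩ := QuotientGroup.mk_surjective x
    rw [MulAction.Quotient.smul_mk, hQ, hQ, MulAction.Quotient.smul_mk]
    simp
  change π _ = _
  simp only [t', h1, Equiv.symm_apply_apply, map_mul, map_inv]

/-- The elementary step: a splitting of a central extension over an open normal subgroup `V` with
cyclic quotient of order `p` yields a splitting over the whole group.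

The obstruction to making a splitting `ψ` over `V` invariant is the character
`χ = ψ / ψ ^ σ` of `V`, whose transfer vanishes. A `p`-th root `μ` of `χ` can be chosen with
vanishing transfer, so with trivial norm `N μ = ∏ μ ^ (σ ^ i)`, and then `χ = μ ^ p / N μ` is
visibly a coboundary `Λ / Λ ^ σ`. So `ψ / Λ` is invariant, hence extends to a character `θ`, and
dividing `θ` by a `p`-th root of `θ ^ p` makes it `p`-torsion. -/
theorem exists_splitting_of_normal_subgroup (p : ℕ) [Fact p.Prime]
    {G E : Type u} [Group G] [TopologicalSpace G] [IsTopologicalGroup G] [CompactSpace G]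
    [TotallyDisconnectedSpace G] [Group E] [TopologicalSpace E] [IsTopologicalGroup E]
    [CompactSpace E] (π : E →* G) (hπ : Continuous π) (hs : Function.Surjective π)
    (hc : π.ker ≤ Subgroup.center E) (V : OpenSubgroup G) [V.toSubgroup.Normal]
    (hind : V.toSubgroup.index = p)
    (σ : G) (hσ : ∀ g : G, ∃ k : ℕ, (σ ^ k)⁻¹ * g ∈ V.toSubgroup)
    (hG : CharactersDivisible p G) (hV : CharactersDivisible p V.toSubgroup)
    (hcor : TransferSurjective p V.toSubgroup)
    (ψ : V.toSubgroup.comap π →* PruferGroup p) (hψ : Continuous ψ) (hψp : ∀ e, ψ e ^ p = 1)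
    (hψ1 : ∃ z : V.toSubgroup.comap π, π z = 1 ∧ ψ z ≠ 1) :
    ∃ ψ : E →* PruferGroup p, Continuous ψ ∧ (∀ e, ψ e ^ p = 1) ∧ ∃ z, π z = 1 ∧ ψ z ≠ 1 := by
  let EV : Subgroup E := V.toSubgroup.comap π
  have hEVo : IsOpen (EV : Set E) := V.isOpen.preimage hπ
  have : CompactSpace EV := (OpenSubgroup.mk EV hEVo).instCompactSpaceToSubgroup
  have : EV.FiniteIndex := (OpenSubgroup.mk EV hEVo).instFiniteIndexToSubgroup
  let πV : EV →* V.toSubgroup := π.subgroupComap V.toSubgroup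
  have hπV : Continuous πV := (hπ.comp continuous_subtype_val).subtype_mk _
  have hsV : Function.Surjective πV := by
    rintro ⟨v, hv⟩
    obtain ⟨e, rfl⟩ := hs v
    exact ⟨⟨e, hv⟩, rfl⟩
  obtain ⟨σ', rfl⟩ := hs σ
  let cE : EV →* EV := (MulAut.conjNormal σ'⁻¹).toMonoidHom
  have hcE : ∀ e : EV, (cE e : E) = σ'⁻¹ * e * σ' := fun e =>
    (MulAut.conjNormal_apply _ _).trans (by rw [inv_inv])
  have hcEc : Continuous cE := by
    refine continuous_induced_rng.2 ?_
    refine Continuous.congr (f := fun e : EV => σ'⁻¹ * (e : E) * σ') (by fun_prop)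
      fun e => (hcE e).symm
  let c : ℕ → V.toSubgroup →* V.toSubgroup := fun k =>
    (MulAut.conjNormal (π σ' ^ k)⁻¹).toMonoidHom
  have hck : ∀ k (v : V.toSubgroup), (c k v : G) = (π σ' ^ k)⁻¹ * v * π σ' ^ k := fun k v =>
    (MulAut.conjNormal_apply _ _).trans (by rw [inv_inv])
  have hcc : ∀ k, Continuous (c k) := fun k => by
    refine continuous_induced_rng.2 ?_
    refine Continuous.congr (f := fun v : V.toSubgroup => (π σ' ^ k)⁻¹ * (v : G) * π σ' ^ k)
      (by fun_prop) fun e => (hck k e).symm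
  have hcπ : ∀ e, πV (cE e) = c 1 (πV e) := fun e => by
    ext
    rw [hck]
    change π (cE e) = _
    rw [hcE, map_mul, map_mul, map_inv, pow_one]
    rfl
  -- the obstruction `χ` to the invariance of `ψ`
  obtain ⟨χ, hχ, hχψ⟩ := exists_continuous_descent πV hπV hsV (ψ / ψ.comp cE)
    (hψ.div' (hψ.comp hcEc)) (by
      intro e he
      have h1 : (e : E) ∈ π.ker := congrArg Subtype.val he
      have h2 : cE e = e := by
        ext
        rw [hcE, mul_assoc, ← Subgroup.mem_center_iff.1 (hc h1), inv_mul_cancel_left]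
      rw [MonoidHom.mem_ker, MonoidHom.div_apply, MonoidHom.comp_apply, h2, div_self'])
  have hχcor : ∀ g, MonoidHom.transfer χ g = 1 := fun g => by
    obtain ⟨e, rfl⟩ := hs g
    rw [← MonoidHom.transfer_comap V.toSubgroup π hs χ e]
    have h1 : ψ = χ.comp πV * ψ.comp cE := by
      ext e
      rw [MonoidHom.mul_apply, MonoidHom.comp_apply, hχψ, MonoidHom.div_apply, div_mul_cancel]
    have h2 := MonoidHom.transfer_mul (χ.comp πV) (ψ.comp cE) e
    rw [← h1, MonoidHom.transfer_conj ψ (ψ.comp cE) σ' (fun v v' h => by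
      rw [MonoidHom.comp_apply]
      congr 1
      ext
      rw [hcE, h])] at h2
    exact (mul_eq_right.1 h2.symm)
  -- a root `μ` of `χ` with vanishing transfer
  obtain ⟨μ, hμ, hμχ, hμcor⟩ : ∃ μ : V.toSubgroup →* PruferGroup p, Continuous μ ∧
      (∀ v, μ v ^ p = χ v) ∧ ∀ g, MonoidHom.transfer μ g = 1 := by
    obtain ⟨μ, hμ, hμχ⟩ := hV χ hχ
    obtain ⟨l, hl, hlp, hlt⟩ := hcor (MonoidHom.transfer μ)
      (continuous_transfer_character V μ hμ) (fun g => by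
        have h1 : (powMonoidHom p).comp μ = χ := by
          ext v
          exact congrArg Multiplicative.toAdd (hμχ v)
        have h2 := MonoidHom.transfer_comp μ (powMonoidHom p) g
        rw [h1, hχcor] at h2
        exact h2.symm)
    refine ⟨μ / l, hμ.div' hl, fun v => by
      rw [MonoidHom.div_apply, div_pow, hlp, div_one, hμχ], fun g => ?_⟩
    have h2 := MonoidHom.transfer_mul (μ / l) l g
    rw [div_mul_cancel, hlt] at h2
    exact (mul_eq_right.1 h2.symm)
  -- powers of `σ` as coset representatives
  have hk : ∀ q : G ⧸ V.toSubgroup, ∃ k : ℕ, (QuotientGroup.mk (π σ' ^ k) : G ⧸ _) = q := by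
    intro q
    obtain ⟨g, rfl⟩ := QuotientGroup.mk_surjective q
    obtain ⟨k, hk⟩ := hσ g
    exact ⟨k, QuotientGroup.eq.2 hk⟩
  choose k hk using hk
  let _ := V.toSubgroup.fintypeQuotientOfFiniteIndex
  have hnorm : ∀ v : V.toSubgroup, ∏ q, μ (c (k q) v) = 1 := fun v => by
    rw [← hμcor v, MonoidHom.transfer_eq_prod_section _ _ hk v
      (MonoidHom.transfer_section_mem _ hk v)]
    refine Finset.prod_congr rfl fun q _ => congrArg μ (Subtype.ext ?_)
    have h1 : (v : G)⁻¹ • q = q := by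
      obtain ⟨g, rfl⟩ := QuotientGroup.mk_surjective q
      rw [MulAction.Quotient.smul_mk, QuotientGroup.eq]
      have := (inferInstance : V.toSubgroup.Normal).conj_mem v v.2 g⁻¹
      simpa [mul_assoc] using this
    simp only [h1, hck, mul_assoc]
  -- by telescoping, each `μ / μ ^ (σ ^ k)` is a coboundary
  have hcob : ∀ k, ∃ L : V.toSubgroup →* PruferGroup p, Continuous L ∧
      ∀ v, μ v / μ (c k v) = L v / L (c 1 v) := by
    intro k
    induction k with
    | zero =>
      refine ⟨1, continuous_const, fun v => ?_⟩
      have : c 0 v = v := by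
        ext
        simp [hck]
      simp [this]
    | succ k ih =>
      obtain ⟨L, hL, h⟩ := ih
      refine ⟨L * μ.comp (c k), hL.mul (hμ.comp (hcc k)), fun v => ?_⟩
      have h1 : c k (c 1 v) = c (k + 1) v := by
        ext
        rw [hck, hck, hck, pow_succ']
        group
      rw [← div_mul_div_cancel _ (μ (c k v)), h, MonoidHom.mul_apply, MonoidHom.mul_apply,
        MonoidHom.comp_apply, MonoidHom.comp_apply, h1, mul_div_mul_comm]
  choose L hL hLμ using hcob
  let Λ : V.toSubgroup →* PruferGroup p := ∏ q, L (k q)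
  have hΛ : ∀ v, Λ v = ∏ q, L (k q) v := fun v => MonoidHom.finsetProd_apply _ _ _
  have hΛc : Continuous Λ := by
    refine Continuous.congr (continuous_finsetProd _ fun q _ => hL (k q)) fun v => (hΛ v).symm
  have hΛχ : ∀ v, χ v = Λ v / Λ (c 1 v) := fun v => by
    rw [hΛ, hΛ, ← Finset.prod_div_distrib]
    simp_rw [← hLμ]
    rw [Finset.prod_div_distrib, hnorm, div_one, Finset.prod_const, ← hμχ, Finset.card_univ,
      ← Nat.card_eq_fintype_card]
    exact congrArg _ hind.symm
  -- the corrected splitting is invariant and extends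
  have hσ' : ∀ e : E, ∃ k : ℕ, (σ' ^ k)⁻¹ * e ∈ EV := fun e => by
    obtain ⟨k, hk⟩ := hσ (π e)
    refine ⟨k, ?_⟩
    rw [Subgroup.mem_comap]
    simpa using hk
  obtain ⟨θ, hθ, hθψ⟩ := exists_extension_of_invariant (PruferGroup.baer p) EV hEVo σ' hσ'
    (ψ / Λ.comp πV) (hψ.div' (hΛc.comp hπV)) (fun e e' h => by
      have h1 : e' = cE e := Subtype.ext (h.trans (hcE e).symm)
      have h2 : ψ e / ψ (cE e) = Λ (πV e) / Λ (c 1 (πV e)) := by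
        rw [← hΛχ, hχψ]
        rfl
      rw [h1, MonoidHom.div_apply, MonoidHom.div_apply, MonoidHom.comp_apply,
        MonoidHom.comp_apply, hcπ]
      rw [div_eq_div_iff_mul_eq_mul] at h2 ⊢
      rw [h2, mul_comm])
  have hθz : ∀ z : EV, π z = 1 → θ z = ψ z := fun z hz => by
    have h1 : πV z = 1 := Subtype.ext hz
    rw [hθψ, MonoidHom.div_apply, MonoidHom.comp_apply, h1, map_one, div_one]
  obtain ⟨η', hη', hη'θ⟩ := exists_continuous_descent π hπ hs ((powMonoidHom p).comp θ)
    (hθ.pow p) (fun z hz => by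
      have hz' : z ∈ EV := by
        rw [Subgroup.mem_comap, (show π z = 1 from hz)]
        exact one_mem _
      rw [MonoidHom.mem_ker, MonoidHom.comp_apply, hθz ⟨z, hz'⟩ hz]
      exact hψp _)
  obtain ⟨η, hη, hηη'⟩ := hG η' hη'
  refine ⟨θ / η.comp π, hθ.div' (hη.comp hπ), fun e => ?_, ?_⟩
  · rw [MonoidHom.div_apply, MonoidHom.comp_apply, div_pow, hηη', hη'θ]
    exact div_self' _
  · obtain ⟨z, hz, hz1⟩ := hψ1
    refine ⟨z, hz, ?_⟩
    rw [MonoidHom.div_apply, MonoidHom.comp_apply, hz, map_one, div_one, hθz z hz]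
    exact hz1

theorem exists_character_of_isComplement' (p : ℕ) [Fact p.Prime] {E : Type*} [Group E]
    [TopologicalSpace E] [IsTopologicalGroup E] (Z W : Subgroup E) [W.Normal]
    (h : Z.IsComplement' W) (hZ : Nat.card Z = p) (hW : IsOpen (W : Set E)) :
    ∃ ψ : E →* PruferGroup p, Continuous ψ ∧ (∀ e, ψ e ^ p = 1) ∧ ∃ z ∈ Z, ψ z ≠ 1 := by
  have : IsCyclic Z := isCyclic_of_prime_card hZ
  obtain ⟨g, hg⟩ := IsCyclic.exists_generator (α := Z)
  let ι : Z →* PruferGroup p := monoidHomOfForallMemZpowers (g := g) (g' := PruferGroup.zeta p) hg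
    (by
      rw [orderOf_eq_card_of_forall_mem_zpowers hg, hZ]
      exact orderOf_dvd_of_pow_eq_one (PruferGroup.zeta_pow p))
  have hι : ι g = PruferGroup.zeta p := monoidHomOfForallMemZpowers_apply_gen hg _
  let r : E ⧸ W →* Z := (h.QuotientMulEquiv).toMonoidHom
  have hr : ∀ z : Z, r (QuotientGroup.mk (z : E)) = z := fun z => by
    exact h.QuotientMulEquiv.apply_symm_apply z
  refine ⟨(ι.comp r).comp (QuotientGroup.mk' W), ?_, fun e => ?_, g, g.2, ?_⟩
  · refine MonoidHom.continuous_of_isOpen_ker _ (Subgroup.isOpen_mono (H₁ := W) ?_ hW)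
    intro x hx
    have : (QuotientGroup.mk' W) x = 1 := by
      rwa [QuotientGroup.mk'_apply, QuotientGroup.eq_one_iff]
    rw [MonoidHom.mem_ker, MonoidHom.comp_apply, this, map_one]
  · rw [MonoidHom.comp_apply, MonoidHom.comp_apply, ← map_pow]
    have := pow_card_eq_one' (x := r ((QuotientGroup.mk' W) e))
    rw [hZ] at this
    rw [this, map_one]
  · change ι (r (QuotientGroup.mk (g : E))) ≠ 1
    rw [hr, hι]
    exact PruferGroup.zeta_ne_one p

theorem CharactersDivisible.of_equiv {p : ℕ} [Fact p.Prime] {A B : Type u} [Group A]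
    [TopologicalSpace A] [Group B] [TopologicalSpace B] (h : CharactersDivisible p A)
    (e : A ≃* B) (he : Continuous e) (he' : Continuous e.symm) : CharactersDivisible p B := by
  intro χ hχ
  obtain ⟨μ, hμ, hμχ⟩ := h (χ.comp e.toMonoidHom) (hχ.comp he)
  refine ⟨μ.comp e.symm.toMonoidHom, hμ.comp he', fun g => ?_⟩
  have := hμχ (e.symm g)
  simpa using this

/-- In a pro-`p` group every proper open normal subgroup `V` is contained with index `p` in an
open normal subgroup `U`. -/
theorem exists_openNormalSubgroup_index_eq {p : ℕ} [Fact p.Prime] {G : Type u} [Group G]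
    [TopologicalSpace G] [IsTopologicalGroup G] [CompactSpace G] [TotallyDisconnectedSpace G]
    (hG : IsProP p G) (V : OpenNormalSubgroup G) (hV : V.toSubgroup ≠ ⊤) :
    ∃ U : OpenNormalSubgroup G, V.toSubgroup ≤ U.toSubgroup ∧
      V.toSubgroup.relIndex U.toSubgroup = p ∧
      ∃ σ ∈ U.toSubgroup, ∀ g ∈ U.toSubgroup, ∃ k : ℕ, (σ ^ k)⁻¹ * g ∈ V.toSubgroup := by
  have hP : IsPGroup p (G ⧸ V.toSubgroup) := hG V
  have : Finite (G ⧸ V.toSubgroup) := Subgroup.quotient_finite_of_isOpen _ V.isOpen'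
  have : Nontrivial (G ⧸ V.toSubgroup) := by
    rw [← not_subsingleton_iff_nontrivial, QuotientGroup.subsingleton_iff]
    exact hV
  obtain ⟨z, hzc, hz⟩ := hP.exists_mem_center_orderOf_eq
  obtain ⟨σ, rfl⟩ := QuotientGroup.mk_surjective z
  have hn := Subgroup.normal_zpowers_of_mem_center hzc
  let q := QuotientGroup.mk' V.toSubgroup
  have hle : V.toSubgroup ≤ (Subgroup.zpowers (q σ)).comap q := fun v hv => by
    have : q v = 1 := by rwa [QuotientGroup.mk'_apply, QuotientGroup.eq_one_iff]
    rw [Subgroup.mem_comap, this]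
    exact one_mem _
  let U : OpenNormalSubgroup G :=
    { toSubgroup := (Subgroup.zpowers (q σ)).comap q
      isOpen' := Subgroup.isOpen_mono hle V.isOpen'
      isNormal' := hn.comap q }
  refine ⟨U, hle, ?_, σ, Subgroup.mem_zpowers (q σ), fun g hg => ?_⟩
  · have h1 : V.toSubgroup = (⊥ : Subgroup (G ⧸ V.toSubgroup)).comap q := by
      rw [MonoidHom.comap_bot]
      exact (QuotientGroup.ker_mk' _).symm
    rw [h1, Subgroup.relIndex_comap, Subgroup.map_comap_eq_self_of_surjective
      (QuotientGroup.mk'_surjective _), Subgroup.relIndex_bot_left, Nat.card_zpowers]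
    exact hz
  · have hg : q g ∈ Subgroup.zpowers (q σ) := hg
    rw [← mem_powers_iff_mem_zpowers] at hg
    obtain ⟨k, hk⟩ := hg
    exact ⟨k, QuotientGroup.eq.1 hk⟩

/-- Central extensions of order `p` always split over some open normal subgroup. -/
theorem exists_splitting_over_openNormalSubgroup {p : ℕ} [Fact p.Prime] {G E : Type u} [Group G]
    [TopologicalSpace G] [IsTopologicalGroup G] [CompactSpace G] [TotallyDisconnectedSpace G]
    [Group E] [TopologicalSpace E] [IsTopologicalGroup E] [CompactSpace E]
    [TotallyDisconnectedSpace E] (π : E →* G) (hπ : Continuous π) (hs : Function.Surjective π)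
    (hk : Nat.card π.ker = p) :
    ∃ V : OpenNormalSubgroup G, ∃ ψ : V.toSubgroup.comap π →* PruferGroup p,
      Continuous ψ ∧ (∀ e, ψ e ^ p = 1) ∧
        ∃ z : V.toSubgroup.comap π, π z = 1 ∧ ψ z ≠ 1 := by
  have hf : Finite π.ker := Nat.finite_of_card_ne_zero (hk ▸ (Fact.out : p.Prime).ne_zero)
  obtain ⟨W, hWk⟩ := π.ker.exists_openNormalSubgroup_disjoint
  have hopen : IsOpenMap π := MonoidHom.isOpenMap_of_sigmaCompact π hs hπ
  let V : OpenNormalSubgroup G :=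
    { toSubgroup := W.toSubgroup.map π
      isOpen' := hopen _ W.isOpen'
      isNormal' := W.isNormal'.map π hs }
  refine ⟨V, ?_⟩
  let EV := V.toSubgroup.comap π
  let Z : Subgroup EV := π.ker.subgroupOf EV
  let W' : Subgroup EV := W.toSubgroup.subgroupOf EV
  have hZV : π.ker ≤ EV := fun z hz => by
    rw [Subgroup.mem_comap, (show π z = 1 from hz)]
    exact one_mem _
  have hc : Z.IsComplement' W' := by
    refine Subgroup.isComplement'_of_disjoint_and_mul_eq_univ ?_ ?_
    · rw [Subgroup.disjoint_def]
      intro x hx hx'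
      exact Subtype.ext (hWk _ hx' hx)
    · refine Set.eq_univ_of_forall fun e => ?_
      obtain ⟨w, hw, hwe⟩ := e.2
      have hwV : w ∈ EV := ⟨w, hw, rfl⟩
      refine ⟨e * ⟨w, hwV⟩⁻¹, ?_, ⟨w, hwV⟩, hw, by simp⟩
      change π (e * w⁻¹) = 1
      rw [map_mul, map_inv, hwe, mul_inv_cancel]
  obtain ⟨ψ, hψ, hψp, z, hz, hz1⟩ := exists_character_of_isComplement' p Z W' hc
    (by rw [← hk]; exact Nat.card_congr (Subgroup.subgroupOfEquivOfLe hZV).toEquiv)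
    (W.isOpen'.preimage continuous_subtype_val)
  exact ⟨ψ, hψ, hψp, z, hz, hz1⟩

theorem centralExtensionsSplit_of_transferSurjective {p : ℕ} [Fact p.Prime] {G : Type u} [Group G]
    [TopologicalSpace G] [IsTopologicalGroup G] [CompactSpace G] [TotallyDisconnectedSpace G]
    (hG : IsProP p G) (h1 : ∀ U : OpenNormalSubgroup G, CharactersDivisible p U.toSubgroup)
    (h2 : ∀ (U : OpenNormalSubgroup G) (V : OpenSubgroup U.toSubgroup), V.toSubgroup.Normal →
      TransferSurjective p V.toSubgroup) : CentralExtensionsSplit p G := by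
  intro E _ _ _ _ _ hE π hπ hs hc hk
  have key : ∀ (n : ℕ) (V : OpenNormalSubgroup G), V.toSubgroup.index = n →
      (∃ ψ : V.toSubgroup.comap π →* PruferGroup p, Continuous ψ ∧ (∀ e, ψ e ^ p = 1) ∧
        ∃ z : V.toSubgroup.comap π, π z = 1 ∧ ψ z ≠ 1) →
      ∃ ψ : E →* PruferGroup p, Continuous ψ ∧ (∀ e, ψ e ^ p = 1) ∧ ∃ z ∈ π.ker, ψ z ≠ 1 := by
    intro n
    induction n using Nat.strong_induction_on with
    | _ n ih =>
      rintro V rfl ⟨ψ, hψ, hψp, z, hz, hz1⟩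
      by_cases hV : V.toSubgroup = ⊤
      · let j : E →* V.toSubgroup.comap π :=
          (MonoidHom.id E).codRestrict _ fun e => by
            rw [hV]
            exact Subgroup.mem_top (π e)
        refine ⟨ψ.comp j, hψ.comp (continuous_id.subtype_mk _), fun e => hψp _, z, hz, ?_⟩
        exact hz1
      obtain ⟨U, hVU, hind, σ, hσ, hσV⟩ := exists_openNormalSubgroup_index_eq hG V hV
      have hVi : V.toSubgroup.index ≠ 0 :=
        (V.toOpenSubgroup.instFiniteIndexToSubgroup).index_ne_zero
      refine ih U.toSubgroup.index ?_ U rfl ?_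
      · have h := Subgroup.relIndex_mul_index hVU
        rw [hind] at h
        rw [← h] at hVi ⊢
        exact lt_mul_of_one_lt_left (Nat.pos_of_ne_zero (right_ne_zero_of_mul hVi))
          (Fact.out : p.Prime).one_lt
      let V' : OpenSubgroup U.toSubgroup :=
        ⟨V.toSubgroup.subgroupOf U.toSubgroup, V.isOpen'.preimage continuous_subtype_val⟩
      have hV'n : V'.toSubgroup.Normal := V.isNormal'.subgroupOf _
      have hEU : IsClosed (U.toSubgroup.comap π : Set E) := U.toOpenSubgroup.isClosed.preimage hπ
      have : CompactSpace (U.toSubgroup.comap π) := isCompact_iff_compactSpace.mp hEU.isCompact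
      have hcU : CompactSpace U.toSubgroup := U.toOpenSubgroup.instCompactSpaceToSubgroup
      let π' := π.subgroupComap U.toSubgroup
      have hπ' : Continuous π' := (hπ.comp continuous_subtype_val).subtype_mk _
      have hs' : Function.Surjective π' := by
        rintro ⟨g, hg⟩
        obtain ⟨e, rfl⟩ := hs g
        exact ⟨⟨e, hg⟩, rfl⟩
      have hc' : π'.ker ≤ Subgroup.center _ := fun x hx => by
        have hx' : (x : E) ∈ π.ker := congrArg Subtype.val hx
        rw [Subgroup.mem_center_iff]
        intro y
        exact Subtype.ext (Subgroup.mem_center_iff.1 (hc hx') y)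
      let j : V'.toSubgroup.comap π' →* V.toSubgroup.comap π :=
        ((U.toSubgroup.comap π).subtype.comp (Subgroup.subtype _)).codRestrict _ fun x => x.2
      have hj : Continuous j :=
        (continuous_subtype_val.comp continuous_subtype_val).subtype_mk _
      have hzU : (z : E) ∈ U.toSubgroup.comap π := hVU z.2
      obtain ⟨ψ', hψ', hψ'p, z', hz', hz'1⟩ := exists_splitting_of_normal_subgroup p π' hπ' hs' hc'
        V' hind ⟨σ, hσ⟩ (fun g => hσV g g.2) (h1 U)
        ((h1 V).of_equiv (Subgroup.subgroupOfEquivOfLe hVU).symm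
          ((continuous_subtype_val.subtype_mk _).subtype_mk _)
          ((continuous_subtype_val.comp continuous_subtype_val).subtype_mk _))
        (h2 U V' hV'n) (ψ.comp j) (hψ.comp hj) (fun e => hψp _)
        ⟨⟨⟨z, hzU⟩, z.2⟩, Subtype.ext hz, hz1⟩
      exact ⟨ψ', hψ', hψ'p, z', congrArg Subtype.val hz', hz'1⟩
  obtain ⟨V, hV⟩ := exists_splitting_over_openNormalSubgroup π hπ hs hk
  exact key _ V rfl hV

/-! ### Tensoring with `ℚ_p / ℤ_p` -/

section Tensor

variable (p : ℕ) [Fact p.Prime]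

/-- Multiplication by `z ∈ ℤ_p` on `ℚ_p / ℤ_p`, as a bi-additive map. -/
noncomputable def QpModZp.padicMul : ℤ_[p] →+ QpModZp p →+ QpModZp p :=
  AddMonoidHom.mk' (fun z => QuotientAddGroup.map _ _ (AddMonoidHom.mulLeft (z : ℚ_[p])) (by
    intro x hx
    exact (PadicInt.subring p).mul_mem z.2 hx)) (by
    intro z w
    ext x
    change (QuotientAddGroup.mk (((z + w : ℤ_[p]) : ℚ_[p]) * x) : QpModZp p) =
      QuotientAddGroup.mk ((z : ℚ_[p]) * x) + QuotientAddGroup.mk ((w : ℚ_[p]) * x)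
    rw [← QuotientAddGroup.mk_add, PadicInt.coe_add, add_mul])

/-- The class of `p ^ (-n)` in `ℚ_p / ℤ_p`. -/
noncomputable def QpModZp.invPow (n : ℕ) : QpModZp p := QuotientAddGroup.mk ((p : ℚ_[p]) ^ n)⁻¹

variable {p}

theorem padic_natCast_ne_zero : (p : ℚ_[p]) ≠ 0 := by
  exact_mod_cast (Fact.out : p.Prime).ne_zero

theorem QpModZp.pow_nsmul_invPow (n m : ℕ) :
    p ^ m • QpModZp.invPow p (n + m) = QpModZp.invPow p n := by
  rw [QpModZp.invPow, ← QuotientAddGroup.mk_nsmul, QpModZp.invPow, nsmul_eq_mul]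
  congr 1
  have := padic_natCast_ne_zero (p := p)
  push_cast
  rw [pow_add]
  field_simp

theorem QpModZp.invPow_zero : QpModZp.invPow p 0 = 0 := by
  rw [QpModZp.invPow, QpModZp.mk_eq_zero_iff]
  simp

theorem QpModZp.exists_eq_nsmul_invPow (x : QpModZp p) :
    ∃ k n : ℕ, x = k • QpModZp.invPow p n := by
  obtain ⟨x, rfl⟩ := QuotientAddGroup.mk_surjective x
  have hp := padic_natCast_ne_zero (p := p)
  obtain ⟨n, hn⟩ : ∃ n : ℕ, ‖(p : ℚ_[p]) ^ n * x‖ ≤ 1 := by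
    have h1 : Tendsto (fun n : ℕ => (p : ℚ_[p]) ^ n * x) atTop (𝓝 (0 * x)) :=
      (tendsto_pow_atTop_nhds_zero_of_norm_lt_one Padic.norm_p_lt_one).mul_const x
    rw [zero_mul] at h1
    obtain ⟨n, hn⟩ := (h1.eventually (Metric.closedBall_mem_nhds 0 one_pos)).exists
    exact ⟨n, by simpa using hn⟩
  let y : ℤ_[p] := ⟨_, hn⟩
  refine ⟨y.appr n, n, ?_⟩
  rw [QpModZp.invPow, ← QuotientAddGroup.mk_nsmul, ← sub_eq_zero, ← QuotientAddGroup.mk_sub,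
    QpModZp.mk_eq_zero_iff]
  obtain ⟨z, hz⟩ := Ideal.mem_span_singleton.1 (PadicInt.appr_spec n y)
  have h2 : (p : ℚ_[p]) ^ n * x - (y.appr n : ℚ_[p]) = (p : ℚ_[p]) ^ n * z := by
    have := congrArg (fun t : ℤ_[p] => (t : ℚ_[p])) hz
    simpa using this
  have h3 : x - y.appr n • ((p : ℚ_[p]) ^ n)⁻¹ = z := by
    rw [nsmul_eq_mul]
    field_simp
    linear_combination h2
  rw [h3]
  exact z.2

theorem exists_eq_tmul_invPow {A : Type*} [AddCommGroup A] (t : A ⊗[ℤ] QpModZp p) :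
    ∃ (a : A) (n : ℕ), t = a ⊗ₜ[ℤ] QpModZp.invPow p n := by
  induction t using TensorProduct.induction_on with
  | zero => exact ⟨0, 0, (TensorProduct.zero_tmul _ _).symm⟩
  | tmul a x =>
    obtain ⟨k, n, rfl⟩ := QpModZp.exists_eq_nsmul_invPow x
    exact ⟨k • a, n, (TensorProduct.smul_tmul k a _).symm⟩
  | add s t hs ht =>
    obtain ⟨a, n, rfl⟩ := hs
    obtain ⟨b, m, rfl⟩ := ht
    refine ⟨p ^ m • a + p ^ n • b, n + m, ?_⟩
    rw [TensorProduct.add_tmul, TensorProduct.smul_tmul, TensorProduct.smul_tmul,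
      QpModZp.pow_nsmul_invPow, add_comm n m, QpModZp.pow_nsmul_invPow]

/-- In a product of copies of `ℤ_p`, the element `a ⊗ p ^ (-n)` vanishes only if `p ^ n`
divides `a`: this is seen on each coordinate. -/
theorem exists_eq_nsmul_of_tmul_invPow_eq_zero {A I : Type*} [AddCommGroup A]
    (e : A ≃+ (I → ℤ_[p])) {a : A} {n : ℕ} (h : a ⊗ₜ[ℤ] QpModZp.invPow p n = 0) :
    ∃ a', a = p ^ n • a' := by
  have h1 : ∀ i, ‖(e a i : ℚ_[p]) * ((p : ℚ_[p]) ^ n)⁻¹‖ ≤ 1 := by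
    intro i
    let f : A →+ QpModZp p →+ QpModZp p :=
      (QpModZp.padicMul p).comp ((Pi.evalAddMonoidHom _ i).comp e.toAddMonoidHom)
    let F := TensorProduct.liftAddHom (R := ℤ) f (fun r m x => by
      rw [map_zsmul, map_zsmul]
      rfl)
    have h2 : F (a ⊗ₜ[ℤ] QpModZp.invPow p n) = 0 := by rw [h, map_zero]
    rw [TensorProduct.liftAddHom_tmul] at h2
    exact (QpModZp.mk_eq_zero_iff p).1 h2
  let w : I → ℤ_[p] := fun i => ⟨_, h1 i⟩
  have hw : ∀ i, (w i : ℚ_[p]) = (e a i : ℚ_[p]) * ((p : ℚ_[p]) ^ n)⁻¹ := fun i => rfl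
  refine ⟨e.symm w, e.injective ?_⟩
  rw [map_nsmul, e.apply_symm_apply]
  refine funext fun i => Subtype.ext ?_
  have := padic_natCast_ne_zero (p := p)
  rw [Pi.smul_apply, nsmul_eq_mul, PadicInt.coe_mul, hw]
  push_cast
  field_simp

theorem eq_zero_of_nsmul_eq_zero {B J : Type*} [AddCommGroup B] (e : B ≃+ (J → ℤ_[p])) {b : B}
    (h : p • b = 0) : b = 0 := by
  rw [← map_eq_zero_iff e e.injective]
  have h1 : p • e b = 0 := by rw [← map_nsmul, h, map_zero]
  ext i
  have h2 : p • e b i = 0 := congrFun h1 i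
  rw [nsmul_eq_mul, mul_eq_zero] at h2
  have h3 : (p : ℤ_[p]) ≠ 0 := by exact_mod_cast (Fact.out : p.Prime).ne_zero
  simp [h2.resolve_left h3]

/-- A homomorphism to a product of copies of `ℤ_p` that is injective modulo `p` is injective modulo
every power of `p`, because the target is torsion free; and every element of `A ⊗ ℚ_p / ℤ_p` is a
single tensor `a ⊗ p ^ (-n)`. -/
theorem rTensor_injective_of_forall_nsmul {A B J : Type*} [AddCommGroup A] [AddCommGroup B]
    (eB : B ≃+ (J → ℤ_[p])) (f : A →+ B)
    (h : ∀ a b, f a = p • b → ∃ a', a = p • a') :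
    Function.Injective (f.toIntLinearMap.rTensor (QpModZp p)) := by
  have h' : ∀ (n : ℕ) a b, f a = p ^ n • b → ∃ a', a = p ^ n • a' := by
    intro n
    induction n with
    | zero => exact fun a b _ => ⟨a, by simp⟩
    | succ n ih =>
      intro a b hab
      obtain ⟨a1, rfl⟩ := h a (p ^ n • b) (by rw [hab, pow_succ', mul_smul])
      have h1 : f a1 = p ^ n • b := by
        rw [← sub_eq_zero]
        apply eq_zero_of_nsmul_eq_zero eB
        rw [smul_sub, ← map_nsmul, hab, pow_succ', mul_smul, sub_self]
      obtain ⟨a2, rfl⟩ := ih a1 b h1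
      exact ⟨a2, by rw [pow_succ', mul_smul]⟩
  rw [injective_iff_map_eq_zero]
  intro t ht
  obtain ⟨a, n, rfl⟩ := exists_eq_tmul_invPow t
  rw [LinearMap.rTensor_tmul] at ht
  obtain ⟨b, hb⟩ := exists_eq_nsmul_of_tmul_invPow_eq_zero eB ht
  obtain ⟨a', rfl⟩ := h' n a b hb
  have h0 := QpModZp.pow_nsmul_invPow (p := p) 0 n
  rw [zero_add, QpModZp.invPow_zero] at h0
  rw [TensorProduct.smul_tmul, h0, TensorProduct.tmul_zero]

end Tensor

section

variable {p : ℕ} [Fact p.Prime] {G : Type u} [Group G] [TopologicalSpace G]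
  [IsTopologicalGroup G]

theorem IsZpFree.charactersDivisible [CompactSpace G] [TotallyDisconnectedSpace G]
    (h : IsZpFree p (TopologicalAbelianization G)) : CharactersDivisible p G := by
  obtain ⟨I, ⟨e⟩⟩ := h
  refine charactersDivisible_of_torsionFree p fun x hx => ?_
  exact eq_zero_of_nsmul_eq_zero (b := Additive.ofMul x) e.toAddEquiv hx

theorem transferSurjective_of_verTensor_injective [CompactSpace G] [TotallyDisconnectedSpace G]
    (hG : IsZpFree p (TopologicalAbelianization G)) (V : OpenSubgroup G)
    (h : Function.Injective (verTensor p V)) : TransferSurjective p V.toSubgroup := by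
  obtain ⟨I, ⟨e⟩⟩ := hG
  refine transferSurjective_of_ver p V fun x y hxy => ?_
  have h1 : Additive.ofMul x ⊗ₜ[ℤ] QpModZp.invPow p 1 = 0 := by
    apply h
    rw [map_zero]
    refine (LinearMap.rTensor_tmul _ _ _ _).trans ?_
    have h2 : (MonoidHom.toAdditive (ver V)).toIntLinearMap (Additive.ofMul x) =
        p ^ 1 • Additive.ofMul y := by
      rw [pow_one]
      exact hxy
    have h0 := QpModZp.pow_nsmul_invPow (p := p) 0 1
    rw [zero_add, QpModZp.invPow_zero] at h0
    rw [h2, TensorProduct.smul_tmul, h0, TensorProduct.tmul_zero]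
  obtain ⟨a', ha⟩ := exists_eq_nsmul_of_tmul_invPow_eq_zero e.toAddEquiv h1
  exact ⟨a'.toMul, by rw [pow_one] at ha; exact ha⟩

theorem centralExtensionsSplit_of_isZpFree [CompactSpace G] [TotallyDisconnectedSpace G]
    (hG : IsProP p G)
    (h1 : ∀ U : OpenNormalSubgroup G, IsZpFree p (TopologicalAbelianization U.toSubgroup))
    (h2 : ∀ (U : OpenSubgroup G) (V : OpenSubgroup U.toSubgroup), V.toSubgroup.Normal →
      Function.Injective (verTensor p V)) : CentralExtensionsSplit p G :=
  centralExtensionsSplit_of_transferSurjective hG (fun U => (h1 U).charactersDivisible)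
    fun U V hV => transferSurjective_of_verTensor_injective (h1 U) V (h2 U.toOpenSubgroup V hV)

end

/-! ### Lifting families converging to `1` -/

/-- An approximation to a lift of `e : X → Q` along `q : G → Q`: a closed normal subgroup `N` of
`G` and, for each `x`, a coset `C x` of `N` in the fibre of `q` over `e x`. The cosets converge
to `1` in `G ⧸ N`, so that for `N = 1` they form a lift of `e` converging to `1`. -/
structure IsCosetLift {G Q X : Type*} [Group G] [TopologicalSpace G] (q : G → Q) (e : X → Q)
    (N : Subgroup G) (C : X → Set G) : Prop where
  normal : N.Normal
  isClosed : IsClosed (N : Set G)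
  nonempty : ∀ x, (C x).Nonempty
  mem_iff : ∀ x, ∀ g ∈ C x, ∀ h, h ∈ C x ↔ g⁻¹ * h ∈ N
  map_eq : ∀ x, ∀ g ∈ C x, q g = e x
  eventually : ∀ W : OpenNormalSubgroup G, ∀ᶠ x in cofinite, ∃ h ∈ C x, h ∈ W.toSubgroup

section Lift

variable {G Q X : Type*} [Group G] [TopologicalSpace G] [IsTopologicalGroup G]

theorem IsCosetLift.isClosed_coset {q : G → Q} {e : X → Q} {N : Subgroup G} {C : X → Set G}
    (h : IsCosetLift q e N C) (x : X) : IsClosed (C x) := by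
  obtain ⟨g, hg⟩ := h.nonempty x
  have : C x = (fun y => g⁻¹ * y) ⁻¹' (N : Set G) := by
    ext y
    exact h.mem_iff x g hg y
  rw [this]
  exact h.isClosed.preimage (continuous_const.mul continuous_id)

theorem IsCosetLift.iInter_nonempty [CompactSpace G] {q : G → Q} {e : X → Q} {ι : Type*}
    [Nonempty ι] (N : ι → Subgroup G) (C : ι → X → Set G) (h : ∀ i, IsCosetLift q e (N i) (C i))
    (hd : ∀ i j, ∃ k, N k ≤ N i ∧ N k ≤ N j ∧ ∀ x, C k x ⊆ C i x ∧ C k x ⊆ C j x) (x : X) :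
    (⋂ i, C i x).Nonempty := by
  refine IsCompact.nonempty_iInter_of_directed_nonempty_isCompact_isClosed _ ?_
    (fun i => (h i).nonempty x) (fun i => ((h i).isClosed_coset x).isCompact)
    fun i => (h i).isClosed_coset x
  intro i j
  obtain ⟨k, -, -, hk⟩ := hd i j
  exact ⟨k, (hk x).1, (hk x).2⟩

theorem IsCosetLift.exists_lower_bound [CompactSpace G] {q : G → Q} {e : X → Q} {ι : Type*}
    [Nonempty ι] (N : ι → Subgroup G) (C : ι → X → Set G) (h : ∀ i, IsCosetLift q e (N i) (C i))
    (hd : ∀ i j, ∃ k, N k ≤ N i ∧ N k ≤ N j ∧ ∀ x, C k x ⊆ C i x ∧ C k x ⊆ C j x) :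
    IsCosetLift q e (⨅ i, N i) (fun x => ⋂ i, C i x) where
  normal := Subgroup.normal_iInf_normal fun i => (h i).normal
  isClosed := by
    rw [Subgroup.coe_iInf]
    exact isClosed_iInter fun i => (h i).isClosed
  nonempty := IsCosetLift.iInter_nonempty N C h hd
  mem_iff x g hg y := by
    rw [Set.mem_iInter] at hg
    rw [Set.mem_iInter, Subgroup.mem_iInf]
    exact forall_congr' fun i => (h i).mem_iff x g (hg i) y
  map_eq x g hg := (h (Classical.arbitrary ι)).map_eq x g (Set.mem_iInter.1 hg _)
  eventually W := by
    let T : Subgroup G := W.toSubgroup ⊔ ⨅ i, N i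
    have hT : IsOpen (T : Set G) := Subgroup.isOpen_mono le_sup_left W.isOpen'
    -- by compactness some `N i` lies in the open subgroup `T`
    obtain ⟨i, hi⟩ : ∃ i, N i ≤ T := by
      by_contra! hcon
      obtain ⟨y, hy⟩ := IsCompact.nonempty_iInter_of_directed_nonempty_isCompact_isClosed
        (fun i => (N i : Set G) ∩ (T : Set G)ᶜ) (by
          intro i j
          obtain ⟨k, hki, hkj, -⟩ := hd i j
          exact ⟨k, Set.inter_subset_inter_left _ hki, Set.inter_subset_inter_left _ hkj⟩)
        (fun i => by
          obtain ⟨y, hy, hyT⟩ := SetLike.not_le_iff_exists.1 (hcon i)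
          exact ⟨y, hy, hyT⟩)
        (fun i => ((h i).isClosed.inter hT.isClosed_compl).isCompact)
        fun i => (h i).isClosed.inter hT.isClosed_compl
      rw [Set.mem_iInter] at hy
      exact (hy (Classical.arbitrary ι)).2
        ((le_sup_right : _ ≤ T) (Subgroup.mem_iInf.2 fun i => (hy i).1))
    filter_upwards [(h i).eventually W] with x hx
    obtain ⟨w, hwC, hwW⟩ := hx
    obtain ⟨g, hg⟩ := IsCosetLift.iInter_nonempty N C h hd x
    have hgi : w⁻¹ * g ∈ T := hi (((h i).mem_iff x w hwC g).1 (Set.mem_iInter.1 hg i))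
    have hgT : g ∈ T := by
      have := T.mul_mem ((le_sup_left : _ ≤ T) hwW) hgi
      rwa [mul_inv_cancel_left] at this
    rw [Subgroup.mem_sup_of_normal_left] at hgT
    obtain ⟨v, hv, n, hn, rfl⟩ := hgT
    refine ⟨v, ?_, hv⟩
    rw [Set.mem_iInter] at hg ⊢
    intro i
    rw [(h i).mem_iff x _ (hg i), mul_inv_rev, inv_mul_cancel_right]
    exact inv_mem (Subgroup.mem_iInf.1 hn i)

theorem IsCosetLift.exists_smaller [CompactSpace G] {q : G → Q} {e : X → Q}
    {N : Subgroup G} {C : X → Set G} (h : IsCosetLift q e N C) (V : OpenNormalSubgroup G) :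
    ∃ C', IsCosetLift q e (N ⊓ V.toSubgroup) C' ∧ ∀ x, C' x ⊆ C x := by
  classical
  -- representatives of the cosets, taken in `V` wherever possible
  have hg : ∀ x, ∃ g ∈ C x, (∃ h ∈ C x, h ∈ V.toSubgroup) → g ∈ V.toSubgroup := fun x => by
    by_cases hx : ∃ h ∈ C x, h ∈ V.toSubgroup
    · obtain ⟨g, hg, hgV⟩ := hx
      exact ⟨g, hg, fun _ => hgV⟩
    · obtain ⟨g, hg⟩ := h.nonempty x
      exact ⟨g, hg, fun hx' => absurd hx' hx⟩
  choose g hgC hgV using hg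
  refine ⟨fun x => {y | y ∈ C x ∧ (g x)⁻¹ * y ∈ V.toSubgroup}, ⟨?_, ?_, ?_, ?_, ?_, ?_⟩,
    fun x y hy => hy.1⟩
  · have := h.normal
    infer_instance
  · exact h.isClosed.inter V.toOpenSubgroup.isClosed
  · exact fun x => ⟨g x, hgC x, by simp⟩
  · rintro x y ⟨hy, hyV⟩ z
    have h1 : (g x)⁻¹ * z = ((g x)⁻¹ * y) * (y⁻¹ * z) := by group
    rw [Set.mem_ofPred_eq, h.mem_iff x y hy z, h1, Subgroup.mul_mem_cancel_left _ hyV]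
    rfl
  · exact fun x y hy => h.map_eq x y hy.1
  · intro W
    filter_upwards [h.eventually (W ⊓ V)] with x hx
    obtain ⟨y, hy, hyW, hyV⟩ := hx
    exact ⟨y, ⟨hy, mul_mem (inv_mem (hgV x ⟨y, hy, hyV⟩)) hyV⟩, hyW⟩

/-- A family converging to `1` lifts along a continuous surjection of profinite groups to a family
converging to `1`, by Zorn's lemma for coset lifts. -/
theorem exists_lift_tendsto_one [CompactSpace G] [TotallyDisconnectedSpace G] [Group Q]
    [TopologicalSpace Q] [IsTopologicalGroup Q] [T2Space Q] (q : G →* Q) (hq : Continuous q)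
    (hs : Function.Surjective q) (e : X → Q) (he : Tendsto e cofinite (𝓝 1)) :
    ∃ s : X → G, Tendsto s cofinite (𝓝 1) ∧ ∀ x, q (s x) = e x := by
  have : CompactSpace Q := hs.compactSpace hq
  have hopen : IsOpenMap q := MonoidHom.isOpenMap_of_sigmaCompact q hs hq
  let S : Set (Subgroup G × (X → Set G))ᵒᵈ :=
    {a | IsCosetLift q e (OrderDual.ofDual a).1 (OrderDual.ofDual a).2}
  have hbase : IsCosetLift q e q.ker (fun x => q ⁻¹' {e x}) :=
    { normal := inferInstance
      isClosed := isClosed_singleton.preimage hq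
      nonempty := fun x => hs (e x)
      mem_iff := fun x g hg h => by
        have hg : q g = e x := hg
        rw [MonoidHom.mem_ker, map_mul, map_inv, hg, inv_mul_eq_one, eq_comm]
        rfl
      map_eq := fun x g hg => hg
      eventually := fun W => by
        have h1 : q '' W.toSubgroup ∈ 𝓝 1 :=
          (hopen _ W.isOpen').mem_nhds ⟨1, W.toSubgroup.one_mem, map_one q⟩
        filter_upwards [he h1] with x hx
        obtain ⟨w, hw, hwx⟩ := hx
        exact ⟨w, hwx, hw⟩ }
  obtain ⟨m, -, hm⟩ := zorn_le_nonempty₀ S (fun c hc hchain y hy => by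
    have : Nonempty c := ⟨⟨y, hy⟩⟩
    refine ⟨OrderDual.toDual (⨅ i : c, (OrderDual.ofDual i.1).1,
      fun x => ⋂ i : c, (OrderDual.ofDual i.1).2 x), ?_, ?_⟩
    · refine IsCosetLift.exists_lower_bound _ _ (fun i => hc i.2) ?_
      intro i j
      rcases hchain.total i.2 j.2 with hij | hij
      · have hij : OrderDual.ofDual j.1 ≤ OrderDual.ofDual i.1 := hij
        exact ⟨j, hij.1, le_rfl, fun x => ⟨hij.2 x, subset_rfl⟩⟩
      · have hij : OrderDual.ofDual i.1 ≤ OrderDual.ofDual j.1 := hij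
        exact ⟨i, le_rfl, hij.1, fun x => ⟨subset_rfl, hij.2 x⟩⟩
    · intro z hz
      exact ⟨iInf_le (fun i : c => (OrderDual.ofDual i.1).1) ⟨z, hz⟩,
        fun x => Set.iInter_subset (fun i : c => (OrderDual.ofDual i.1).2 x) ⟨z, hz⟩⟩)
    (OrderDual.toDual (q.ker, fun x => q ⁻¹' {e x})) hbase
  obtain ⟨N, C⟩ := m
  have hNC : IsCosetLift q e N C := hm.prop
  have hN : N = ⊥ := by
    rw [Subgroup.eq_bot_iff_forall]
    intro n hn
    by_contra h1
    obtain ⟨V, hV⟩ := ProfiniteGrp.exist_openNormalSubgroup_sub_open_nhds_of_one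
      (isOpen_compl_singleton (x := n)) (fun h => h1 (Set.mem_singleton_iff.1 h).symm)
    obtain ⟨C', hC', hC'C⟩ := hNC.exists_smaller V
    have hle : OrderDual.ofDual (OrderDual.toDual (N, C)) ≤ (N ⊓ V.toSubgroup, C') :=
      hm.le_of_ge (y := OrderDual.toDual (N ⊓ V.toSubgroup, C')) hC' ⟨inf_le_left, hC'C⟩
    exact hV (hle.1 hn).2 rfl
  subst hN
  choose s hsC using hNC.nonempty
  refine ⟨s, ?_, fun x => hNC.map_eq x _ (hsC x)⟩
  rw [tendsto_def]
  intro O hO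
  obtain ⟨O', hO', hO1, hO2⟩ := mem_nhds_iff.1 hO
  obtain ⟨W, hW⟩ := ProfiniteGrp.exist_openNormalSubgroup_sub_open_nhds_of_one hO1 hO2
  filter_upwards [hNC.eventually W] with x hx
  obtain ⟨h, hC, hhW⟩ := hx
  have h1 := (hNC.mem_iff x _ (hsC x) h).1 hC
  rw [Subgroup.mem_bot, inv_mul_eq_one] at h1
  rw [Set.mem_preimage, h1]
  exact hO' (hW hhW)

end Lift

/-! ### Minimal generating families of pro-`p` groups -/

/-- The continuous homomorphisms `G → 𝔽_p`, that is `H¹(G, 𝔽_p)`, as a vector space of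
functions. -/
def continuousHomZMod (p : ℕ) (G : Type u) [Group G] [TopologicalSpace G] :
    Submodule (ZMod p) (G → ZMod p) where
  carrier := {f | Continuous f ∧ ∀ g h, f (g * h) = f g + f h}
  add_mem' := by
    rintro f f' ⟨hf, hf'⟩ ⟨hg, hg'⟩
    refine ⟨hf.add hg, fun g h => ?_⟩
    rw [Pi.add_apply, Pi.add_apply, Pi.add_apply, hf', hg']
    abel
  zero_mem' := ⟨continuous_const, fun g h => by simp⟩
  smul_mem' := by
    rintro c f ⟨hf, hf'⟩
    refine ⟨(continuous_of_discreteTopology (f := fun a : ZMod p => c • a)).comp hf, fun g h => ?_⟩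
    rw [Pi.smul_apply, Pi.smul_apply, Pi.smul_apply, hf', smul_add]

section

variable {p : ℕ} [Fact p.Prime] {G : Type u} [Group G] [TopologicalSpace G]

theorem continuousHomZMod.map_one (f : continuousHomZMod p G) : f.1 1 = 0 := by
  have := f.2.2 1 1
  simpa using this

theorem continuousHomZMod.map_inv (f : continuousHomZMod p G) (g : G) : f.1 g⁻¹ = - f.1 g := by
  have := f.2.2 g g⁻¹
  rw [mul_inv_cancel, continuousHomZMod.map_one] at this
  exact (neg_eq_of_add_eq_zero_right this.symm).symm

/-- The multiplicative form of an element of `H¹(G, 𝔽_p)`. -/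
def continuousHomZMod.toMonoidHom (f : continuousHomZMod p G) : G →* Multiplicative (ZMod p) where
  toFun g := Multiplicative.ofAdd (f.1 g)
  map_one' := continuousHomZMod.map_one f
  map_mul' := f.2.2

/-- Linearly independent elements of `H¹(G, 𝔽_p)` take arbitrary values simultaneously. -/
theorem continuousHomZMod.exists_eq_of_linearIndependent [CompactSpace G] {X : Type*}
    (b : X → continuousHomZMod p G) (hb : LinearIndependent (ZMod p) b) (t : X → ZMod p) :
    ∃ g : G, ∀ x, (b x).1 g = t x := by
  classical
  have hne : (⋂ x, {g : G | (b x).1 g = t x}).Nonempty := by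
    refine CompactSpace.iInter_nonempty
      (fun x => isClosed_eq (b x).2.1 continuous_const) fun T => ?_
    let L' : AddSubgroup (T → ZMod p) :=
      { carrier := Set.range fun (g : G) (x : T) => (b x).1 g
        add_mem' := by
          rintro _ _ ⟨g, rfl⟩ ⟨h, rfl⟩
          exact ⟨g * h, funext fun x => (b x).2.2 g h⟩
        zero_mem' := ⟨1, funext fun x => continuousHomZMod.map_one (b x)⟩
        neg_mem' := by
          rintro _ ⟨g, rfl⟩
          exact ⟨g⁻¹, funext fun x => continuousHomZMod.map_inv (b x) g⟩ }
    let L : Submodule (ZMod p) (T → ZMod p) := AddSubgroup.toZModSubmodule p L'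
    have hL : L = ⊤ := by
      by_contra hL
      obtain ⟨f, hf, hfL⟩ := L.exists_le_ker_of_lt_top (lt_top_iff_ne_top.2 hL)
      apply hf
      have h1 : ∑ x : T, f (Pi.single x 1) • b x = 0 := by
        refine Subtype.ext (funext fun g => ?_)
        have h2 : f (fun x => (b x).1 g) = 0 := hfL ⟨g, rfl⟩
        rw [LinearMap.pi_apply_eq_sum_univ f] at h2
        rw [Submodule.coe_sum, Finset.sum_apply, Submodule.coe_zero, Pi.zero_apply, ← h2]
        refine Finset.sum_congr rfl fun x _ => ?_
        rw [Submodule.coe_smul, Pi.smul_apply, smul_eq_mul, smul_eq_mul, mul_comm]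
        congr 2
        ext y
        simp [Pi.single_apply, eq_comm]
      have h3 : LinearIndependent (ZMod p) fun x : T => b x :=
        hb.comp _ Subtype.val_injective
      have h4 := Fintype.linearIndependent_iff.1 h3 _ h1
      refine LinearMap.pi_ext' fun x => LinearMap.ext_ring ?_
      simpa using h4 x
    have ht : (fun x : T => t x) ∈ L := hL ▸ Submodule.mem_top
    obtain ⟨g, hg⟩ := ht
    exact ⟨g, Set.mem_iInter₂.2 fun x hx => congrFun hg ⟨x, hx⟩⟩
  obtain ⟨g, hg⟩ := hne
  exact ⟨g, Set.mem_iInter.1 hg⟩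

/-- The embedding `𝔽_p → ℚ_p / ℤ_p` with image the `p`-torsion. -/
noncomputable def zmodToPrufer (p : ℕ) [Fact p.Prime] :
    Multiplicative (ZMod p) →* PruferGroup p :=
  AddMonoidHom.toMultiplicative (ZMod.lift p ⟨zmultiplesHom _ (PruferGroup.zeta p).toAdd, by
    change (p : ℤ) • (PruferGroup.zeta p).toAdd = 0
    rw [natCast_zsmul]
    exact PruferGroup.zeta_pow p⟩)

theorem zmodToPrufer_ofAdd_one :
    zmodToPrufer p (Multiplicative.ofAdd 1) = PruferGroup.zeta p := by
  have h := ZMod.lift_coe p ⟨zmultiplesHom _ (PruferGroup.zeta p).toAdd, by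
    change (p : ℤ) • (PruferGroup.zeta p).toAdd = 0
    rw [natCast_zsmul]
    exact PruferGroup.zeta_pow p⟩ 1
  rw [Int.cast_one] at h
  exact (congrArg Multiplicative.ofAdd h).trans (one_zsmul (PruferGroup.zeta p).toAdd)

/-- A proper closed subgroup of a pro-`p` group lies in the kernel of a nonzero continuous
homomorphism to `𝔽_p`: it lies in a maximal open subgroup, which is normal of index `p`. -/
theorem exists_continuousHomZMod_ne_zero [IsTopologicalGroup G] [CompactSpace G]
    [TotallyDisconnectedSpace G] (hG : IsProP p G) (L : Subgroup G) (hL : IsClosed (L : Set G))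
    (hL' : L ≠ ⊤) : ∃ f : continuousHomZMod p G, f ≠ 0 ∧ ∀ g ∈ L, f.1 g = 0 := by
  obtain ⟨g, hg⟩ : ∃ g, g ∉ L := by
    by_contra! h
    exact hL' (eq_top_iff.2 fun g _ => h g)
  obtain ⟨W, hW⟩ := ProfiniteGrp.exist_openNormalSubgroup_sub_open_nhds_of_one
    (hL.isOpen_compl.preimage (continuous_const_mul g)) (by simpa using hg)
  let q := QuotientGroup.mk' W.toSubgroup
  have hP : IsPGroup p (G ⧸ W.toSubgroup) := hG W
  have : Finite (G ⧸ W.toSubgroup) := Subgroup.quotient_finite_of_isOpen _ W.isOpen'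
  have hLq : L.map q ≠ ⊤ := by
    intro h
    obtain ⟨l, hl, hlg⟩ := (h ▸ Subgroup.mem_top (q g) : q g ∈ L.map q)
    have h1 : g⁻¹ * l ∈ W.toSubgroup := QuotientGroup.eq.1 hlg.symm
    have h2 : g * (g⁻¹ * l) ∉ L := hW h1
    rw [mul_inv_cancel_left] at h2
    exact h2 hl
  obtain ⟨M, hM, hLM⟩ := (eq_top_or_exists_le_coatom (L.map q)).resolve_left hLq
  have := hP.isNilpotent
  have hMn : M.Normal := Subgroup.NormalizerCondition.normal_of_coatom M
    Group.normalizerCondition_of_isNilpotent hM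
  let Q := (G ⧸ W.toSubgroup) ⧸ M
  have hQ : IsPGroup p Q := hP.to_quotient M
  have : Nontrivial Q := by
    rw [← not_subsingleton_iff_nontrivial, QuotientGroup.subsingleton_iff]
    exact hM.1
  obtain ⟨z, hz⟩ := exists_prime_orderOf_dvd_card' p hQ.dvd_natCard
  have hz1 : z ≠ 1 := fun h => by
    rw [h, orderOf_one] at hz
    exact (Fact.out : p.Prime).one_lt.ne hz
  have htop : (Subgroup.zpowers z).comap (QuotientGroup.mk' M) = ⊤ := by
    refine hM.2 _ (lt_of_le_of_ne ?_ ?_)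
    · intro m hm
      have : QuotientGroup.mk' M m = 1 := by rwa [QuotientGroup.mk'_apply, QuotientGroup.eq_one_iff]
      rw [Subgroup.mem_comap, this]
      exact one_mem _
    · intro h
      obtain ⟨y, rfl⟩ := QuotientGroup.mk'_surjective M z
      have hy : y ∈ M := by
        rw [h, Subgroup.mem_comap]
        exact Subgroup.mem_zpowers _
      apply hz1
      rwa [QuotientGroup.mk'_apply, QuotientGroup.eq_one_iff]
  have hgen : ∀ x : Q, x ∈ Subgroup.zpowers z := fun x => by
    obtain ⟨y, rfl⟩ := QuotientGroup.mk'_surjective M x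
    have : y ∈ (Subgroup.zpowers z).comap (QuotientGroup.mk' M) := htop ▸ Subgroup.mem_top y
    exact this
  let F : Q →* Multiplicative (ZMod p) :=
    monoidHomOfForallMemZpowers (g := z) (g' := Multiplicative.ofAdd (1 : ZMod p)) hgen (by
      rw [hz]
      refine orderOf_dvd_of_pow_eq_one ?_
      change p • (1 : ZMod p) = 0
      simp)
  have hFz : F z = Multiplicative.ofAdd 1 := monoidHomOfForallMemZpowers_apply_gen hgen _
  let r : G →* Q := (QuotientGroup.mk' M).comp q
  have hr : ∀ g, q g ∈ M → r g = 1 := fun g hg => by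
    rwa [MonoidHom.comp_apply, QuotientGroup.mk'_apply, QuotientGroup.eq_one_iff]
  have hcont : Continuous (F.comp r) := by
    refine MonoidHom.continuous_of_isOpen_ker _ (Subgroup.isOpen_mono (H₁ := W.toSubgroup) ?_
      W.isOpen')
    intro x hx
    have : q x = 1 := by rwa [QuotientGroup.mk'_apply, QuotientGroup.eq_one_iff]
    rw [MonoidHom.mem_ker, MonoidHom.comp_apply, hr x (this ▸ one_mem _), _root_.map_one]
  refine ⟨⟨fun g => (F (r g)).toAdd, hcont, fun g h => ?_⟩, fun h => ?_, fun g hg => ?_⟩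
  · change (F (r (g * h))).toAdd = _
    rw [map_mul, map_mul]
    rfl
  · obtain ⟨y, hy⟩ := QuotientGroup.mk'_surjective M z
    obtain ⟨x, hx⟩ := QuotientGroup.mk'_surjective W.toSubgroup y
    have h1 : (F (r x)).toAdd = 0 := congrFun (congrArg Subtype.val h) x
    have h2 : r x = z := by rw [MonoidHom.comp_apply, hx, hy]
    rw [h2, hFz] at h1
    exact one_ne_zero h1
  · change (F (r g)).toAdd = 0
    rw [hr g (hLM ⟨g, hg, rfl⟩), _root_.map_one]
    rfl

/-- A pro-`p` group has a generating family `s` converging to `1` which admits a family of dual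
characters of order `p`; so `s` maps to a basis of the Frattini quotient. -/
theorem IsProP.exists_generators [IsTopologicalGroup G] [CompactSpace G]
    [TotallyDisconnectedSpace G] (hG : IsProP p G) :
    ∃ (X : Type u) (s : X → G), Tendsto s cofinite (𝓝 1) ∧
      (∀ L : Subgroup G, IsClosed (L : Set G) → (∀ x, s x ∈ L) → L = ⊤) ∧
      ∀ x, ∃ χ : G →* PruferGroup p, Continuous χ ∧ χ (s x) = PruferGroup.zeta p ∧
        ∀ y, y ≠ x → χ (s y) = 1 := by
  classical
  let X := Module.Basis.ofVectorSpaceIndex (ZMod p) (continuousHomZMod p G)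
  let b : Module.Basis X (ZMod p) (continuousHomZMod p G) := Module.Basis.ofVectorSpace _ _
  let Φ : G →* Multiplicative (X → ZMod p) :=
    { toFun := fun g => Multiplicative.ofAdd fun x => (b x).1 g
      map_one' := funext fun x => continuousHomZMod.map_one (b x)
      map_mul' := fun g h => funext fun x => (b x).2.2 g h }
  have hΦ : Continuous Φ := continuous_pi fun x => (b x).2.1
  have hΦs : Function.Surjective Φ := fun t => by
    obtain ⟨g, hg⟩ := continuousHomZMod.exists_eq_of_linearIndependent b b.linearIndependent t
    exact ⟨g, funext hg⟩
  have : T2Space (Multiplicative (X → ZMod p)) := inferInstanceAs (T2Space (X → ZMod p))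
  obtain ⟨s, hs, hse⟩ := exists_lift_tendsto_one Φ hΦ hΦs
    (fun x => Multiplicative.ofAdd (Pi.single x 1)) (by
      refine (tendsto_pi_nhds (g := (0 : X → ZMod p))
        (f := fun x => (Pi.single x 1 : X → ZMod p))).2 fun y => ?_
      refine tendsto_nhds_of_eventually_eq ?_
      filter_upwards [(Set.finite_singleton y).compl_mem_cofinite] with x hx
      exact Pi.single_eq_of_ne (Ne.symm hx) _)
  have hsb : ∀ x y, (b y).1 (s x) = (Pi.single x 1 : X → ZMod p) y := fun x y =>
    congrFun (hse x) y
  refine ⟨X, s, hs, fun L hL hsL => ?_, fun x => ?_⟩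
  · by_contra hL'
    obtain ⟨f, hf, hfL⟩ := exists_continuousHomZMod_ne_zero hG L hL hL'
    apply hf
    refine b.repr.injective (Finsupp.ext fun x => ?_)
    -- evaluation at `s x` is the coordinate function of index `x`
    let ev : continuousHomZMod p G →ₗ[ZMod p] ZMod p :=
      (LinearMap.proj (s x)).comp (Submodule.subtype _)
    have h1 : ev = b.coord x := b.ext fun y => by
      rw [Module.Basis.coord_apply, Module.Basis.repr_self]
      change (b y).1 (s x) = _
      rw [hsb, Finsupp.single_apply, Pi.single_apply]
    have h2 : ev f = 0 := hfL _ (hsL x)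
    rw [h1, Module.Basis.coord_apply] at h2
    simpa using h2
  · refine ⟨(zmodToPrufer p).comp (continuousHomZMod.toMonoidHom (b x)),
      (continuous_of_discreteTopology (f := zmodToPrufer p)).comp (b x).2.1, ?_, fun y hy => ?_⟩
    · change zmodToPrufer p (Multiplicative.ofAdd ((b x).1 (s x))) = _
      rw [hsb, Pi.single_eq_same, zmodToPrufer_ofAdd_one]
    · change zmodToPrufer p (Multiplicative.ofAdd ((b x).1 (s y))) = _
      rw [hsb, Pi.single_eq_of_ne hy.symm]
      exact _root_.map_one _

end

/-! ### Pro-`p` groups with split central extensions are free -/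

section

variable {p : ℕ} [Fact p.Prime]

/-- A nontrivial normal subgroup `K` of a pro-`p` group has a central image of order `p` in a
suitable finite quotient. For an open normal subgroup `W` maximal among those not containing `K`,
every nontrivial normal subgroup of the quotient contains the image of `K`; in particular so does
a central subgroup of order `p`. -/
theorem exists_openNormalSubgroup_map_central {E : Type u} [Group E] [TopologicalSpace E]
    [IsTopologicalGroup E] [CompactSpace E] [TotallyDisconnectedSpace E] (hE : IsProP p E)
    (K : Subgroup E) [K.Normal] (hK : K ≠ ⊥) :
    ∃ W : OpenNormalSubgroup E,
      K.map (QuotientGroup.mk' W.toSubgroup) ≤ Subgroup.center (E ⧸ W.toSubgroup) ∧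
      Nat.card (K.map (QuotientGroup.mk' W.toSubgroup)) = p := by
  classical
  have hex : ∃ n, ∃ W : OpenNormalSubgroup E, ¬ K ≤ W.toSubgroup ∧ W.toSubgroup.index = n := by
    obtain ⟨k, hk, hk1⟩ := K.bot_or_exists_ne_one.resolve_left hK
    obtain ⟨W, hW⟩ := ProfiniteGrp.exist_openNormalSubgroup_sub_open_nhds_of_one
      (isOpen_compl_singleton (x := k)) (fun h => hk1 (Set.mem_singleton_iff.1 h).symm)
    exact ⟨_, W, fun hKW => hW (hKW hk) rfl, rfl⟩
  obtain ⟨W, hKW, hWn⟩ := Nat.find_spec hex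
  have hmin : ∀ W' : OpenNormalSubgroup E, W'.toSubgroup.index < W.toSubgroup.index →
      K ≤ W'.toSubgroup := fun W' hW' => by
    by_contra h
    exact Nat.find_min hex (hWn ▸ hW') ⟨W', h, rfl⟩
  let q := QuotientGroup.mk' W.toSubgroup
  have hq1 : ∀ x ∈ W.toSubgroup, q x = 1 := fun x hx => by
    rwa [QuotientGroup.mk'_apply, QuotientGroup.eq_one_iff]
  have hP : IsPGroup p (E ⧸ W.toSubgroup) := hE W
  have : Finite (E ⧸ W.toSubgroup) := Subgroup.quotient_finite_of_isOpen _ W.isOpen'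
  have : Nontrivial (E ⧸ W.toSubgroup) := by
    rw [← not_subsingleton_iff_nontrivial, QuotientGroup.subsingleton_iff]
    intro h
    exact hKW (h ▸ le_top)
  obtain ⟨z, hzc, hz⟩ := hP.exists_mem_center_orderOf_eq
  have hzle : Subgroup.zpowers z ≤ Subgroup.center (E ⧸ W.toSubgroup) := Subgroup.zpowers_le.2 hzc
  have hn := Subgroup.normal_zpowers_of_mem_center hzc
  have hle : W.toSubgroup ≤ (Subgroup.zpowers z).comap q := fun v hv => by
    rw [Subgroup.mem_comap, hq1 v hv]
    exact one_mem _
  let W' : OpenNormalSubgroup E :=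
    { toSubgroup := (Subgroup.zpowers z).comap q
      isOpen' := Subgroup.isOpen_mono hle W.isOpen'
      isNormal' := hn.comap q }
  have hlt : W'.toSubgroup.index < W.toSubgroup.index := by
    have : W.toSubgroup.FiniteIndex := W.toOpenSubgroup.instFiniteIndexToSubgroup
    refine Subgroup.index_strictAnti (lt_of_le_of_ne hle fun h => ?_)
    obtain ⟨x, rfl⟩ := QuotientGroup.mk'_surjective W.toSubgroup z
    have hx : x ∈ W.toSubgroup := by
      rw [h, Subgroup.mem_comap]
      exact Subgroup.mem_zpowers _
    rw [hq1 x hx, orderOf_one] at hz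
    exact (Fact.out : p.Prime).one_lt.ne hz
  have hmap : K.map q ≤ Subgroup.zpowers z := Subgroup.map_le_iff_le_comap.2 (hmin W' hlt)
  refine ⟨W, hmap.trans hzle, ?_⟩
  have hcz : Nat.card (Subgroup.zpowers z) = p := by rw [Nat.card_zpowers, hz]
  have hd : Nat.card (K.map q) ∣ p := hcz ▸ Subgroup.card_dvd_of_le hmap
  refine ((Nat.dvd_prime Fact.out).1 hd).resolve_left fun h1 => hKW fun k hk => ?_
  have h2 := Subgroup.card_eq_one.1 h1
  have h3 : q k ∈ (⊥ : Subgroup (E ⧸ W.toSubgroup)) := h2 ▸ ⟨k, hk, rfl⟩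
  rwa [Subgroup.mem_bot, QuotientGroup.mk'_apply, QuotientGroup.eq_one_iff] at h3

variable {G : Type u} [Group G] [TopologicalSpace G]

theorem CentralExtensionsSplit.exists_character [IsTopologicalGroup G]
    [TotallyDisconnectedSpace G] (h : CentralExtensionsSplit p G)
    {E : Type u} [Group E] [TopologicalSpace E]
    [IsTopologicalGroup E] [CompactSpace E] [TotallyDisconnectedSpace E] (hE : IsProP p E)
    (π : E →* G) (hπ : Continuous π) (hs : Function.Surjective π) (hk : π.ker ≠ ⊥) :
    ∃ ψ : E →* PruferGroup p, Continuous ψ ∧ (∀ e, ψ e ^ p = 1) ∧ ∃ z ∈ π.ker, ψ z ≠ 1 := by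
  obtain ⟨W, hWc, hWp⟩ := exists_openNormalSubgroup_map_central hE π.ker hk
  let q := QuotientGroup.mk' W.toSubgroup
  have hq : Continuous q := continuous_quotient_mk'
  let r : E →* G × (E ⧸ W.toSubgroup) := π.prod q
  have hr : Continuous r := hπ.prodMk hq
  -- the central extension of order `p` of `G` through which `E → G` factors
  let E' : Subgroup (G × (E ⧸ W.toSubgroup)) := r.range
  have : CompactSpace E' := isCompact_iff_compactSpace.mp (isCompact_range hr)
  let r' : E →* E' := r.rangeRestrict
  have hr' : Continuous r' := hr.subtype_mk _
  have hr's : Function.Surjective r' := r.rangeRestrict_surjective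
  let π' : E' →* G := (MonoidHom.fst _ _).comp E'.subtype
  have hπ' : Continuous π' := continuous_fst.comp continuous_subtype_val
  have hπr : ∀ e, π' (r' e) = π e := fun e => rfl
  have hker : π'.ker = π.ker.map r' := by
    ext x
    obtain ⟨e, rfl⟩ := hr's x
    constructor
    · intro hx
      exact ⟨e, hx, rfl⟩
    · rintro ⟨k, hk, hke⟩
      rw [← hke]
      exact hk
  let f : π'.ker → π.ker.map q := fun x => ⟨x.1.1.2, by
    obtain ⟨k, hk, hke⟩ := hker.le x.2
    rw [← hke]
    exact ⟨k, hk, rfl⟩⟩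
  have hf : Function.Bijective f := by
    constructor
    · rintro ⟨⟨⟨a, b⟩, hab⟩, hx⟩ ⟨⟨⟨a', b'⟩, hab'⟩, hx'⟩ hxx
      have h1 : a = 1 := hx
      have h2 : a' = 1 := hx'
      have h3 : b = b' := congrArg Subtype.val hxx
      subst h1 h2 h3
      rfl
    · rintro ⟨_, k, hk, rfl⟩
      exact ⟨⟨r' k, hk⟩, rfl⟩
  obtain ⟨ψ, hψ, hψp, z, hz, hz1⟩ := h E' (hE.of_surjective r' hr' hr's) π' hπ'
    (fun g => by
      obtain ⟨e, rfl⟩ := hs g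
      exact ⟨r' e, rfl⟩)
    (fun x hx => by
      rw [Subgroup.mem_center_iff]
      intro y
      refine Subtype.ext (Prod.ext ?_ ?_)
      · have h1 : x.1.1 = 1 := hx
        simp [h1]
      · exact Subgroup.mem_center_iff.1 (hWc (f ⟨x, hx⟩).2) y.1.2)
    (by rw [Nat.card_congr (Equiv.ofBijective f hf), hWp])
  obtain ⟨k, hk, rfl⟩ := hker.le hz
  exact ⟨ψ.comp r', hψ.comp hr', fun e => hψp _, k, hk, hz1⟩

/-- A pro-`p` group all of whose central extensions of order `p` split is free pro-`p`, on a
minimal generating family `s`. To extend `φ : X → H`, let `Γ ≤ G × H` be the closed subgroup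
generated by the graph of `s x ↦ φ x`. If `Γ → G` were not injective, there would be a `p`-torsion
character of `Γ` nontrivial on the kernel; but such a character agrees on generators, hence
everywhere, with one coming from `G`. So `Γ` is the graph of the required homomorphism. -/
theorem isFreeProP_of_centralExtensionsSplit [IsTopologicalGroup G] [CompactSpace G]
    [TotallyDisconnectedSpace G] (hG : IsProP p G) (h : CentralExtensionsSplit p G) :
    IsFreeProP p G := by
  classical
  obtain ⟨X, s, hs, hgen, hdual⟩ := hG.exists_generators
  refine ⟨X, s, hs, ?_⟩
  intro H _ _ _ _ _ hH φ hφ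
  let Γ : Subgroup (G × H) :=
    (Subgroup.closure (Set.range fun x => (s x, φ x))).topologicalClosure
  have hΓ : IsClosed (Γ : Set (G × H)) := Subgroup.isClosed_topologicalClosure _
  have : CompactSpace Γ := isCompact_iff_compactSpace.mp hΓ.isCompact
  have hsΓ : ∀ x, (s x, φ x) ∈ Γ := fun x =>
    Subgroup.le_topologicalClosure _ (Subgroup.subset_closure ⟨x, rfl⟩)
  let t : X → Γ := fun x => ⟨_, hsΓ x⟩
  have ht : Tendsto t cofinite (𝓝 1) := tendsto_subtype_rng.2 (hs.prodMk_nhds hφ)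
  have htgen : ∀ T : Subgroup Γ, IsClosed (T : Set Γ) → (∀ x, t x ∈ T) → T = ⊤ := by
    intro T hT htT
    have h1 : Γ ≤ T.map Γ.subtype := by
      refine Subgroup.topologicalClosure_minimal _ ?_ ?_
      · rw [Subgroup.closure_le]
        rintro _ ⟨x, rfl⟩
        exact ⟨t x, htT x, rfl⟩
      · exact hΓ.isClosedMap_subtype_val _ hT
    refine eq_top_iff.2 fun y _ => ?_
    obtain ⟨y', hy', hyy⟩ := h1 y.2
    rwa [← Subtype.ext hyy]
  let π : Γ →* G := (MonoidHom.fst _ _).comp Γ.subtype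
  have hπ : Continuous π := continuous_fst.comp continuous_subtype_val
  have hπs : Function.Surjective π := by
    rw [← MonoidHom.range_eq_top]
    refine hgen _ ?_ fun x => ⟨t x, rfl⟩
    exact (isCompact_range hπ).isClosed
  have hker : π.ker = ⊥ := by
    by_contra hker
    have hΓp : IsProP p Γ := (hG.prod hH).of_isInducing Γ.subtype .subtypeVal
    obtain ⟨ψ, hψ, hψp, z, hz, hz1⟩ := h.exists_character hΓp π hπ hπs hker
    have hfin : {x | ψ (t x) ≠ 1}.Finite := by
      have h1 : ∀ᶠ x in cofinite, ψ (t x) = 1 :=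
        ht.eventually ((ψ.isOpen_ker hψ).mem_nhds ψ.ker.one_mem)
      exact h1
    choose n hn using fun x => PruferGroup.exists_zeta_pow p (hψp (t x))
    choose χ hχ hχ1 hχ0 using hdual
    let χt : G →* PruferGroup p := ∏ x ∈ hfin.toFinset, χ x ^ n x
    have hχt : ∀ g, χt g = ∏ x ∈ hfin.toFinset, χ x g ^ n x := fun g => by
      rw [MonoidHom.finsetProd_apply]
      rfl
    have hχtc : Continuous χt := by
      refine Continuous.congr (continuous_finsetProd _ fun x _ => (hχ x).pow (n x))
        fun v => (hχt v).symm
    have hagree : ∀ y, χt (s y) = ψ (t y) := fun y => by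
      rw [hχt]
      by_cases hy : y ∈ hfin.toFinset
      · rw [Finset.prod_eq_single_of_mem y hy fun x _ hxy => by
          rw [hχ0 x y hxy.symm, one_pow], hχ1, hn]
      · rw [Finset.prod_eq_one fun x hx => by
          rw [hχ0 x y (fun hxy => hy (hxy ▸ hx)), one_pow]]
        by_contra h1
        exact hy (hfin.mem_toFinset.2 (Ne.symm h1))
    have htop := htgen ((χt.comp π).eqLocus ψ) (isClosed_eq (hχtc.comp hπ) hψ) hagree
    have hz2 : z ∈ (χt.comp π).eqLocus ψ := htop ▸ Subgroup.mem_top z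
    have hz3 : χt (π z) = ψ z := hz2
    rw [(show π z = 1 from hz), map_one] at hz3
    exact hz1 hz3.symm
  obtain ⟨F, hF, hFπ⟩ := exists_continuous_descent π hπ hπs
    ((MonoidHom.snd _ _).comp Γ.subtype) (continuous_snd.comp continuous_subtype_val)
    (hker ▸ bot_le)
  refine ⟨⟨F, hF⟩, fun x => hFπ (t x), fun F' hF' => ?_⟩
  have htop := hgen (F'.toMonoidHom.eqLocus F) (isClosed_eq F'.continuous_toFun hF) fun x =>
    (hF' x).trans (hFπ (t x)).symm
  ext g
  have : g ∈ F'.toMonoidHom.eqLocus F := htop ▸ Subgroup.mem_top g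
  exact this

end

/-! ### Lifting properties of free pro-`p` groups -/

/-- Homomorphisms with open kernel from `G` to finite `p`-groups lift along surjections of finite
`p`-groups. For a pro-`p` group this is projectivity. -/
def LiftsAlongFiniteSurjections (p : ℕ) (G : Type u) [Group G] [TopologicalSpace G] : Prop :=
  ∀ (A B : Type u) [Group A] [Group B] [Finite A] [Finite B] (α : A →* B),
    Function.Surjective α → IsPGroup p A → ∀ f : G →* B, IsOpen (f.ker : Set G) →
    ∃ F : G →* A, IsOpen (F.ker : Set G) ∧ ∀ g, α (F g) = f g

section

variable {p : ℕ} {G : Type u} [Group G] [TopologicalSpace G]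
  [IsTopologicalGroup G]

theorem IsFreeProP.liftsAlongFiniteSurjections (h : IsFreeProP p G) :
    LiftsAlongFiniteSurjections p G := by
  classical
  obtain ⟨X, ι, hι, hu⟩ := h
  intro A B _ _ _ _ α hα hA f hf
  let _ : TopologicalSpace A := ⊥
  have : DiscreteTopology A := ⟨rfl⟩
  let _ : TopologicalSpace B := ⊥
  have : DiscreteTopology B := ⟨rfl⟩
  have hB : IsPGroup p B := hA.of_surjective α hα
  have hf1 : ∀ᶠ x in cofinite, f (ι x) = 1 := hι.eventually (hf.mem_nhds f.ker.one_mem)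
  choose l hl using hα
  obtain ⟨F, hF, -⟩ := hu A (isProP_of_isPGroup hA)
    (fun x => if f (ι x) = 1 then 1 else l (f (ι x))) (by
      refine tendsto_nhds_of_eventually_eq ?_
      filter_upwards [hf1] with x hx
      rw [if_pos hx])
  refine ⟨F.toMonoidHom, F.toMonoidHom.isOpen_ker F.continuous_toFun, fun g => ?_⟩
  have hfc := f.continuous_of_isOpen_ker hf
  obtain ⟨F', -, hF'⟩ := hu B (isProP_of_isPGroup hB) (fun x => f (ι x))
    (tendsto_nhds_of_eventually_eq hf1)
  have h1 := hF' ⟨f, hfc⟩ fun x => rfl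
  have h2 := hF' ⟨α.comp F.toMonoidHom,
      (continuous_of_discreteTopology (f := α)).comp F.continuous_toFun⟩
    fun x => by
      change α (F (ι x)) = f (ι x)
      rw [hF]
      split_ifs with hx
      · rw [map_one, hx]
      · exact hl _
  exact DFunLike.congr_fun (h2.trans h1.symm) g

instance SemidirectProduct.instFinite {N H : Type*} [Group N] [Group H] (φ : H →* MulAut N)
    [Finite N] [Finite H] : Finite (N ⋊[φ] H) :=
  Finite.of_equiv _ SemidirectProduct.equivProd.symm

/-- The wreath product `B ≀ Sym Q`. -/
abbrev PermWreath (B Q : Type*) [Group B] : Type _ :=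
  (Q → B) ⋊[mulAutArrow (G := Equiv.Perm Q) (A := Q) (M := B)] Equiv.Perm Q

/-- The homomorphism `G → B ≀ Sym (G ⧸ U)` induced by `f : U → B` and a choice `t` of coset
representatives. -/
def inducedWreathHom {G B : Type*} [Group G] [Group B] (U : Subgroup G) (f : U →* B)
    (t : G ⧸ U → G) (ht : ∀ q, (QuotientGroup.mk (t q) : G ⧸ U) = q) :
    G →* PermWreath B (G ⧸ U) where
  toFun g := ⟨fun q => f ⟨_, MonoidHom.transfer_section_mem t ht g q⟩, MulAction.toPerm g⟩
  map_one' := by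
    refine SemidirectProduct.ext (funext fun q => ?_) (Equiv.ext fun q => one_smul G q)
    have : (⟨_, MonoidHom.transfer_section_mem t ht 1 q⟩ : U) = 1 := by
      ext
      simp
    exact (congrArg f this).trans (map_one f)
  map_mul' g h := by
    refine SemidirectProduct.ext (funext fun q => ?_) (Equiv.ext fun q => mul_smul g h q)
    change _ = f _ * f ⟨_, MonoidHom.transfer_section_mem t ht h (g⁻¹ • q)⟩
    rw [← map_mul]
    refine congrArg f (Subtype.ext ?_)
    simp only [Subgroup.coe_mul, mul_inv_rev, mul_smul]
    group

/-- Open subgroups inherit the lifting property: a lifting problem for `U` induces one for `G`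
with wreath products over `G ⧸ U` (the analogue of Shapiro's lemma). -/
theorem LiftsAlongFiniteSurjections.openSubgroup [CompactSpace G] [TotallyDisconnectedSpace G]
    [Fact p.Prime] (hG : IsProP p G) (h : LiftsAlongFiniteSurjections p G) (U : OpenSubgroup G) :
    LiftsAlongFiniteSurjections p U.toSubgroup := by
  classical
  intro A B _ _ _ _ α hα hA f hf
  let Q := G ⧸ U.toSubgroup
  have : Finite Q := Subgroup.quotient_finite_of_isOpen _ U.isOpen
  let t : Q → G := fun q => if q = QuotientGroup.mk 1 then 1 else q.out
  have ht : ∀ q, (QuotientGroup.mk (t q) : Q) = q := fun q => by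
    by_cases hq : q = QuotientGroup.mk 1
    · simp only [t, if_pos hq]
      exact hq.symm
    · simp only [t, if_neg hq]
      exact QuotientGroup.out_eq' q
  have ht1 : t (QuotientGroup.mk 1) = 1 := if_pos rfl
  have hU1 : ∀ u : U.toSubgroup, (u : G)⁻¹ • (QuotientGroup.mk 1 : Q) = QuotientGroup.mk 1 :=
    fun u => by
      rw [MulAction.Quotient.smul_mk, QuotientGroup.eq]
      simp
  let F := inducedWreathHom U.toSubgroup f t ht
  have hFo : IsOpen (F.ker : Set G) := by
    obtain ⟨N, hN⟩ := ProfiniteGrp.exist_openNormalSubgroup_sub_open_nhds_of_one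
      (U.isOpen.isOpenMap_subtype_val _ hf) ⟨1, f.ker.one_mem, rfl⟩
    refine Subgroup.isOpen_mono (H₁ := N.toSubgroup) (fun g hg => ?_) N.isOpen'
    have hgq : ∀ q, (t q)⁻¹ * g * t q ∈ N.toSubgroup := fun q => by
      simpa using N.isNormal'.conj_mem g hg (t q)⁻¹
    have hgq' : ∀ q : Q, g⁻¹ • q = q := fun q => by
      obtain ⟨⟨u, huU⟩, -, huq⟩ := hN (hgq q)
      have huq : u = (t q)⁻¹ * g * t q := huq
      conv_lhs => rw [← ht q]
      conv_rhs => rw [← ht q]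
      rw [MulAction.Quotient.smul_mk, QuotientGroup.eq]
      rw [huq] at huU
      simpa [mul_assoc] using huU
    refine SemidirectProduct.ext (funext fun q => ?_) (Equiv.ext fun q => ?_)
    · obtain ⟨u, hu, huq⟩ := hN (hgq q)
      change f _ = 1
      rw [← (show f u = 1 from hu)]
      refine congrArg f (Subtype.ext ?_)
      refine Eq.trans ?_ huq.symm
      simp only [hgq', mul_assoc]
    · change g • q = q
      exact (inv_smul_eq_iff.1 (hgq' q)).symm
  -- the induced surjection of wreath products
  let m : PermWreath A Q →* PermWreath B Q :=
    SemidirectProduct.map (α.compLeft Q) (MonoidHom.id _) fun π => by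
      ext n q
      rfl
  have hm : Function.Surjective m := by
    rintro ⟨n, π⟩
    choose n' hn' using fun q => hα (n q)
    exact ⟨⟨n', π⟩, SemidirectProduct.ext (funext hn') rfl⟩
  have hmker : IsPGroup p m.ker := by
    obtain ⟨k, hk⟩ := hA.exists_card_eq
    rintro ⟨x, hx⟩
    refine ⟨k, Subtype.ext ?_⟩
    have hx1 : x.right = 1 := congrArg SemidirectProduct.right hx
    have hx2 : x = SemidirectProduct.inl x.left := SemidirectProduct.ext rfl hx1
    change x ^ p ^ k = 1
    rw [hx2, ← map_pow, ← hk]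
    have : x.left ^ Nat.card A = 1 := funext fun q => pow_card_eq_one'
    rw [this, map_one]
  let R := F.range
  have hR : IsPGroup p R := by
    have h1 := hG ⟨⟨F.ker, hFo⟩, inferInstance⟩
    exact h1.of_surjective (QuotientGroup.rangeKerLift F) (QuotientGroup.rangeKerLift_surjective F)
  let R' := R.comap m
  have hR' : IsPGroup p R' := hR.comap_of_ker_isPGroup m hmker
  obtain ⟨L, hL, hLF⟩ := h R' R (m.subgroupComap R) (by
    rintro ⟨r, hr⟩
    obtain ⟨a, rfl⟩ := hm r
    exact ⟨⟨a, hr⟩, rfl⟩) hR' F.rangeRestrict (by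
      rw [MonoidHom.ker_rangeRestrict]
      exact hFo)
  have hLF' : ∀ g, m (L g : PermWreath A Q) = F g := fun g => congrArg Subtype.val (hLF g)
  have hLr : ∀ g, (L g : PermWreath A Q).right = MulAction.toPerm g := fun g =>
    congrArg SemidirectProduct.right (hLF' g)
  let F' : U.toSubgroup →* A :=
    { toFun := fun u => (L u : PermWreath A Q).left (QuotientGroup.mk 1)
      map_one' := by
        rw [OneMemClass.coe_one, map_one]
        rfl
      map_mul' := fun u v => by
        rw [Subgroup.coe_mul, map_mul, Subgroup.coe_mul, SemidirectProduct.mul_left, hLr]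
        change _ * (L v : PermWreath A Q).left ((u : G)⁻¹ • QuotientGroup.mk 1) = _
        rw [hU1] }
  refine ⟨F', ?_, fun u => ?_⟩
  · refine Subgroup.isOpen_mono (H₁ := L.ker.comap U.toSubgroup.subtype) ?_
      (hL.preimage continuous_subtype_val)
    intro u hu
    have hu : L u = 1 := hu
    change (L u : PermWreath A Q).left (QuotientGroup.mk 1) = 1
    rw [hu]
    rfl
  · have h1 := congrFun (congrArg SemidirectProduct.left (hLF' u)) (QuotientGroup.mk 1)
    refine h1.trans (congrArg f (Subtype.ext ?_))
    simp only [hU1, ht1, inv_one, one_mul, mul_one]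

theorem LiftsAlongFiniteSurjections.centralExtensionsSplit [CompactSpace G]
    [TotallyDisconnectedSpace G] [Fact p.Prime]
    (h : LiftsAlongFiniteSurjections p G) : CentralExtensionsSplit p G := by
  intro E _ _ _ _ _ hE π hπ hs hc hk
  have hf : Finite π.ker := Nat.finite_of_card_ne_zero (hk ▸ (Fact.out : p.Prime).ne_zero)
  obtain ⟨W, hWk⟩ := π.ker.exists_openNormalSubgroup_disjoint
  let q := QuotientGroup.mk' W.toSubgroup
  have hq : ∀ x, q x = 1 ↔ x ∈ W.toSubgroup := fun x => by
    rw [QuotientGroup.mk'_apply, QuotientGroup.eq_one_iff]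
  have : Finite (E ⧸ W.toSubgroup) := Subgroup.quotient_finite_of_isOpen _ W.isOpen'
  let K := π.ker.map q
  have hKn : K.Normal := (inferInstance : π.ker.Normal).map q (QuotientGroup.mk'_surjective _)
  have hKc : K ≤ Subgroup.center _ := by
    rintro _ ⟨k, hk, rfl⟩
    rw [Subgroup.mem_center_iff]
    intro y
    obtain ⟨x, rfl⟩ := QuotientGroup.mk'_surjective _ y
    rw [← map_mul, ← map_mul, Subgroup.mem_center_iff.1 (hc hk) x]
  let r := QuotientGroup.mk' K
  have : DiscreteTopology ((E ⧸ W.toSubgroup) ⧸ K) :=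
    QuotientGroup.discreteTopology (isOpen_discrete _)
  obtain ⟨f, hf, hfπ⟩ := exists_continuous_descent π hπ hs (r.comp q)
    ((continuous_of_discreteTopology (f := r)).comp continuous_quotient_mk') (fun x hx => by
      rw [MonoidHom.mem_ker, MonoidHom.comp_apply, QuotientGroup.mk'_apply,
        QuotientGroup.eq_one_iff]
      exact ⟨x, hx, rfl⟩)
  obtain ⟨l, hl, hlf⟩ := h (E ⧸ W.toSubgroup) _ r (QuotientGroup.mk'_surjective _) (hE W) f
    (f.isOpen_ker hf)
  -- the complement of `ker π` where `q` agrees with the lift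
  let T := q.eqLocus (l.comp π)
  have hT : ∀ e, e ∈ T ↔ q e = l (π e) := fun e => Iff.rfl
  have hql : ∀ e, ∃ z ∈ π.ker, q e = q z * l (π e) := fun e => by
    have h1 : r (q e * (l (π e))⁻¹) = 1 := by
      rw [map_mul, map_inv, hlf, hfπ]
      exact mul_inv_cancel _
    rw [QuotientGroup.mk'_apply, QuotientGroup.eq_one_iff] at h1
    obtain ⟨z, hz, hzq⟩ := h1
    exact ⟨z, hz, by rw [hzq, inv_mul_cancel_right]⟩
  have hTn : T.Normal := by
    refine ⟨fun e he g => ?_⟩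
    obtain ⟨z, hz, hzq⟩ := hql g
    have h1 : q z ∈ Subgroup.center _ := hKc ⟨z, hz, rfl⟩
    rw [hT] at he ⊢
    simp only [map_mul, map_inv, hzq, ← he]
    rw [mul_inv_rev, mul_assoc (q z), mul_assoc (q z), ← Subgroup.mem_center_iff.1 h1]
    group
  have hcompl : π.ker.IsComplement' T := by
    refine Subgroup.isComplement'_of_disjoint_and_mul_eq_univ ?_ ?_
    · rw [Subgroup.disjoint_def]
      intro x hx hx'
      refine hWk x ((hq x).1 ?_) hx
      rw [(hT x).1 hx', (show π x = 1 from hx), map_one]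
    · refine Set.eq_univ_of_forall fun e => ?_
      obtain ⟨z, hz, hzq⟩ := hql e
      refine ⟨z, hz, z⁻¹ * e, ?_, mul_inv_cancel_left z e⟩
      change q _ = l (π _)
      rw [map_mul, map_mul, map_inv, map_inv, (show π z = 1 from hz), hzq, inv_one, one_mul,
        inv_mul_cancel_left]
  refine exists_character_of_isComplement' p π.ker T hcompl hk ?_
  refine Subgroup.isOpen_mono (H₁ := W.toSubgroup ⊓ l.ker.comap π) ?_
    (W.isOpen'.inter (hl.preimage hπ))
  rintro x ⟨hxW, hxl⟩
  rw [hT, (hq x).2 hxW]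
  exact (show l (π x) = 1 from hxl).symm

/-- Under the lifting property every homomorphism to a finite commutative `p`-group `C` is a
transfer from a given open normal subgroup `V`. The coordinate at the trivial coset of a lift of
`(τ, mk) : G → C × G ⧸ V` to the wreath product of `C` by `G ⧸ V` is the required homomorphism. -/
theorem LiftsAlongFiniteSurjections.exists_transfer_eq [CompactSpace G]
    [TotallyDisconnectedSpace G] [Fact p.Prime] (hG : IsProP p G)
    (h : LiftsAlongFiniteSurjections p G) (V : OpenSubgroup G) [hV : V.toSubgroup.Normal]
    {C : Type u} [CommGroup C] [Finite C] (hC : IsPGroup p C) (τ : G →* C)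
    (hτ : IsOpen (τ.ker : Set G)) :
    ∃ χ : V.toSubgroup →* C, IsOpen (χ.ker : Set V.toSubgroup) ∧
      ∀ g, MonoidHom.transfer χ g = τ g := by
  classical
  let K := G ⧸ V.toSubgroup
  have : Finite K := Subgroup.quotient_finite_of_isOpen _ V.isOpen
  let _ := V.toSubgroup.fintypeQuotientOfFiniteIndex
  have hK : IsPGroup p K := hG ⟨V, hV⟩
  let A := (K → C) ⋊[mulAutArrow (G := K) (A := K) (M := C)] K
  have hA : IsPGroup p A := by
    obtain ⟨k, hk⟩ := hC.exists_card_eq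
    obtain ⟨j, hj⟩ := hK.exists_card_eq
    refine IsPGroup.of_card (n := k * Nat.card K + j) ?_
    rw [Nat.card_congr SemidirectProduct.equivProd, Nat.card_prod, Nat.card_fun, hk, pow_add,
      pow_mul, hj]
  let α : A →* C × K :=
    { toFun := fun a => (∏ q, a.left q, a.right)
      map_one' := by
        refine Prod.ext ?_ rfl
        exact Finset.prod_eq_one fun _ _ => rfl
      map_mul' := fun a b => by
        refine Prod.ext ?_ rfl
        change ∏ q, a.left q * b.left (a.right⁻¹ * q) = (∏ q, a.left q) * ∏ q, b.left q
        rw [Finset.prod_mul_distrib]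
        congr 1
        exact Fintype.prod_equiv (Equiv.mulLeft a.right⁻¹) _ _ fun q => rfl }
  have hα : Function.Surjective α := by
    rintro ⟨c, k⟩
    refine ⟨⟨Pi.mulSingle 1 c, k⟩, Prod.ext ?_ rfl⟩
    exact Fintype.prod_pi_mulSingle' 1 c
  let q := QuotientGroup.mk' V.toSubgroup
  obtain ⟨F, hF, hFα⟩ := h A (C × K) α hα hA (τ.prod q) (by
    have h1 : ((τ.prod q).ker : Set G) = (τ.ker : Set G) ∩ V.toSubgroup := by
      rw [MonoidHom.ker_prod, QuotientGroup.ker_mk']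
      rfl
    rw [h1]
    exact hτ.inter V.isOpen)
  have hFr : ∀ g, (F g).right = q g := fun g => congrArg Prod.snd (hFα g)
  have hFτ : ∀ g, ∏ x, (F g).left x = τ g := fun g => congrArg Prod.fst (hFα g)
  have hFmul : ∀ a b x, (F (a * b)).left x = (F a).left x * (F b).left ((q a)⁻¹ * x) :=
    fun a b x => by
      rw [map_mul, SemidirectProduct.mul_left, hFr]
      rfl
  have hq1 : ∀ v : V.toSubgroup, q v = 1 := fun v => by
    rw [QuotientGroup.mk'_apply, QuotientGroup.eq_one_iff]
    exact v.2
  let χ : V.toSubgroup →* C :=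
    { toFun := fun v => (F v).left 1
      map_one' := by
        rw [OneMemClass.coe_one, map_one]
        rfl
      map_mul' := fun v w => by
        rw [Subgroup.coe_mul, hFmul, hq1, inv_one, one_mul] }
  refine ⟨χ, ?_, fun g => ?_⟩
  · refine Subgroup.isOpen_mono (H₁ := F.ker.comap V.toSubgroup.subtype) ?_
      (hF.preimage continuous_subtype_val)
    intro v hv
    have hv : F v = 1 := hv
    change (F v).left 1 = 1
    rw [hv]
    rfl
  · have ht := fun x : K => QuotientGroup.out_eq' x
    have hqt : ∀ x : K, (q x.out⁻¹)⁻¹ * 1 = x := fun x => by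
      rw [← map_inv q, inv_inv, mul_one]
      exact ht x
    rw [MonoidHom.transfer_eq_prod_section _ _ ht g (MonoidHom.transfer_section_mem _ ht g),
      ← hFτ]
    have hterm : ∀ x : K, χ ⟨_, MonoidHom.transfer_section_mem _ ht g x⟩ =
        ((F x.out).left x)⁻¹ * ((F g).left x * (F (g⁻¹ • x).out).left (g⁻¹ • x)) := fun x => by
      change (F (x.out⁻¹ * (g * (g⁻¹ • x).out))).left 1 = _
      have h1 : (F x.out⁻¹).left 1 * (F x.out).left x = 1 := by
        have := hFmul x.out⁻¹ x.out 1
        rw [inv_mul_cancel, map_one, hqt] at this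
        exact this.symm
      have h2 : (q g)⁻¹ * x = g⁻¹ • x := by
        obtain ⟨y, rfl⟩ := QuotientGroup.mk'_surjective _ x
        rfl
      rw [hFmul, hFmul, hqt, h2, eq_inv_of_mul_eq_one_left h1]
    simp_rw [hterm]
    rw [Finset.prod_mul_distrib, Finset.prod_mul_distrib, Finset.prod_inv_distrib,
      Fintype.prod_equiv (MulAction.toPerm g⁻¹)
        (fun x : K => (F (g⁻¹ • x).out).left (g⁻¹ • x)) (fun x : K => (F x.out).left x)
        fun x => rfl, mul_comm, mul_assoc, mul_inv_cancel, mul_one]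

end

/-! ### The abelianization of a free pro-`p` group -/

section

variable {p : ℕ} [Fact p.Prime]

theorem isProP_pi_padicInt (X : Type u) : IsProP p (Multiplicative (X → ℤ_[p])) := by
  rw [isProP_iff_tendsto]
  intro z
  refine (tendsto_pi_nhds (g := (0 : X → ℤ_[p]))
    (f := fun n : ℕ => p ^ n • (z.toAdd : X → ℤ_[p]))).2 fun x => ?_
  have h1 : Tendsto (fun n : ℕ => (p : ℤ_[p]) ^ n * z.toAdd x) atTop (𝓝 (0 * z.toAdd x)) := by
    refine (tendsto_pow_atTop_nhds_zero_of_norm_lt_one ?_).mul_const _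
    rw [PadicInt.norm_p]
    exact inv_lt_one_of_one_lt₀ (by exact_mod_cast (Fact.out : p.Prime).one_lt)
  rw [zero_mul] at h1
  refine h1.congr fun n => ?_
  rw [Pi.smul_apply, nsmul_eq_mul]
  push_cast
  rfl

/-- Closed subgroups of `ℤ_p ^ X` containing the standard generators are everything. -/
theorem eq_top_of_forall_single_mem {X : Type*} [DecidableEq X] (L : AddSubgroup (X → ℤ_[p]))
    (hL : IsClosed (L : Set (X → ℤ_[p]))) (h : ∀ x, Pi.single x 1 ∈ L) : L = ⊤ := by
  have h1 : ∀ x (z : ℤ_[p]), Pi.single x z ∈ L := fun x z => by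
    have hcl : IsClosed {z : ℤ_[p] | (Pi.single x z : X → ℤ_[p]) ∈ L} :=
      hL.preimage (continuous_single x)
    refine PadicInt.denseRange_natCast.induction_on (p := fun z => Pi.single x z ∈ L) z hcl
      fun n => ?_
    have := L.nsmul_mem (h x) n
    rwa [← Pi.single_smul, nsmul_eq_mul, mul_one] at this
  refine eq_top_iff.2 fun t _ => ?_
  -- `t` is the limit of its finite truncations
  refine hL.mem_of_tendsto (f := fun S : Finset X => ∑ x ∈ S, Pi.single x (t x))
    (b := atTop) ?_ (Eventually.of_forall fun S => L.sum_mem fun x _ => h1 x _)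
  refine tendsto_pi_nhds.2 fun y => tendsto_nhds_of_eventually_eq ?_
  filter_upwards [eventually_ge_atTop {y}] with S hS
  rw [Finset.sum_apply, Finset.sum_pi_single, if_pos (hS (Finset.mem_singleton_self y))]

/-- An element `b` of a group of exponent dividing `p ^ n` is the image of `1` under a
homomorphism from `ℤ_p` with open kernel. -/
theorem exists_padicInt_hom {B : Type*} [CommGroup B] (n : ℕ) (b : B) (hb : b ^ p ^ n = 1) :
    ∃ ρ : Multiplicative ℤ_[p] →* B, IsOpen (ρ.ker : Set (Multiplicative ℤ_[p])) ∧
      ρ (Multiplicative.ofAdd 1) = b := by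
  let c : { f : ℤ →+ Additive B // f (p ^ n : ℕ) = 0 } :=
    ⟨zmultiplesHom _ (Additive.ofMul b), by
      rw [zmultiplesHom_apply, natCast_zsmul]
      exact hb⟩
  let ρ : Multiplicative ℤ_[p] →* B := AddMonoidHom.toMultiplicativeLeft
    ((ZMod.lift (p ^ n) c).comp (PadicInt.toZModPow n).toAddMonoidHom)
  refine ⟨ρ, ?_, ?_⟩
  · have h1 : IsOpen (Metric.closedBall (0 : ℤ_[p]) ((p : ℝ) ^ (-n : ℤ))) :=
      IsUltrametricDist.isOpen_closedBall _
        (zpow_ne_zero _ (by exact_mod_cast (Fact.out : p.Prime).ne_zero))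
    let N : AddSubgroup ℤ_[p] := (Ideal.span {(p : ℤ_[p]) ^ n}).toAddSubgroup
    have hN : (N : Set ℤ_[p]) = Metric.closedBall (0 : ℤ_[p]) ((p : ℝ) ^ (-n : ℤ)) := by
      ext z
      rw [mem_closedBall_zero_iff, PadicInt.norm_le_pow_iff_mem_span_pow]
      rfl
    refine Subgroup.isOpen_mono (H₁ := AddSubgroup.toSubgroup N) (fun z hz => ?_) (hN ▸ h1)
    have hz : Multiplicative.toAdd z ∈ Ideal.span {(p : ℤ_[p]) ^ n} := hz
    rw [← PadicInt.ker_toZModPow, RingHom.mem_ker] at hz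
    change ZMod.lift (p ^ n) c (PadicInt.toZModPow n z.toAdd) = 0
    rw [hz, map_zero]
  · change ZMod.lift (p ^ n) c (PadicInt.toZModPow n 1) = Additive.ofMul b
    rw [map_one]
    have h := ZMod.lift_coe (p ^ n) c 1
    rw [Int.cast_one] at h
    exact h.trans (one_zsmul _)

variable {G : Type u} [Group G] [TopologicalSpace G] [IsTopologicalGroup G] [CompactSpace G]
  [TotallyDisconnectedSpace G]

theorem IsFreeProP.isZpFree (hG : IsProP p G) (h : IsFreeProP p G) :
    IsZpFree p (TopologicalAbelianization G) := by
  classical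
  obtain ⟨X, ι, hι, hu⟩ := h
  let φ : X → Multiplicative (X → ℤ_[p]) := fun x => Multiplicative.ofAdd (Pi.single x 1)
  have hφ : Tendsto φ cofinite (𝓝 1) := by
    refine (tendsto_pi_nhds (g := (0 : X → ℤ_[p]))
      (f := fun x => (Pi.single x 1 : X → ℤ_[p]))).2 fun y => ?_
    refine tendsto_nhds_of_eventually_eq ?_
    filter_upwards [(Set.finite_singleton y).compl_mem_cofinite] with x hx
    exact Pi.single_eq_of_ne (Ne.symm hx) _
  have hcpt : CompactSpace (Multiplicative (X → ℤ_[p])) :=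
    inferInstanceAs (CompactSpace (X → ℤ_[p]))
  have hT2 : T2Space (Multiplicative (X → ℤ_[p])) := inferInstanceAs (T2Space (X → ℤ_[p]))
  have htd : TotallyDisconnectedSpace (Multiplicative (X → ℤ_[p])) :=
    inferInstanceAs (TotallyDisconnectedSpace (X → ℤ_[p]))
  obtain ⟨f, hf, -⟩ := hu _ (isProP_pi_padicInt X) φ hφ
  obtain ⟨f', hf', hff'⟩ := TopologicalAbelianization.exists_lift f.toMonoidHom f.continuous_toFun
  have hsurj : Function.Surjective f' := by
    have h1 := eq_top_of_forall_single_mem (MonoidHom.toAdditiveLeft f').range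
      (isCompact_range hf').isClosed fun x => ⟨Additive.ofMul (QuotientGroup.mk (ι x)), by
        change (f' (QuotientGroup.mk (ι x))).toAdd = _
        rw [hff']
        exact congrArg Multiplicative.toAdd (hf x)⟩
    intro y
    obtain ⟨x, hx⟩ := h1 ▸ AddSubgroup.mem_top (Multiplicative.toAdd y)
    exact ⟨x.toMul, hx⟩
  have hinj : Function.Injective f' := by
    rw [injective_iff_map_eq_one]
    intro x hx
    obtain ⟨g, rfl⟩ := QuotientGroup.mk_surjective x
    by_contra hg
    -- a finite abelian quotient in which `g` survives
    obtain ⟨W, hW⟩ := TopologicalAbelianization.exists_openSubgroup_subset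
      {(QuotientGroup.mk g : TopologicalAbelianization G)}ᶜ isClosed_singleton.isOpen_compl
      (fun h => hg (Set.mem_singleton_iff.1 h).symm)
    let B := TopologicalAbelianization G ⧸ W.toSubgroup
    have : Finite B := Subgroup.quotient_finite_of_isOpen _ W.isOpen
    let k : G →* B := (QuotientGroup.mk' W.toSubgroup).comp (QuotientGroup.mk' _)
    have hk : Continuous k := continuous_quotient_mk'.comp continuous_quotient_mk'
    have hks : Function.Surjective k :=
      (QuotientGroup.mk'_surjective _).comp (QuotientGroup.mk'_surjective _)
    have hB : IsProP p B := hG.of_surjective k hk hks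
    obtain ⟨n, hn⟩ := hB.isPGroup.exists_card_eq
    choose ρ hρ hρ1 using fun x => exists_padicInt_hom (p := p) n (k (ι x))
      (hn ▸ pow_card_eq_one')
    have hkι : Tendsto (fun x => k (ι x)) cofinite (𝓝 1) := by
      have := (hk.tendsto 1).comp hι
      rwa [map_one] at this
    have hfin : {x | k (ι x) ≠ 1}.Finite := by
      have h1 : ∀ᶠ x in cofinite, k (ι x) = 1 :=
        hkι.eventually ((isOpen_discrete {(1 : B)}).mem_nhds rfl)
      exact h1
    let ev : X → Multiplicative (X → ℤ_[p]) →* Multiplicative ℤ_[p] := fun x =>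
      AddMonoidHom.toMultiplicative (Pi.evalAddMonoidHom (fun _ : X => ℤ_[p]) x)
    have hev : ∀ x, Continuous (ev x) := fun x => continuous_apply (A := fun _ : X => ℤ_[p]) x
    let Ψ : Multiplicative (X → ℤ_[p]) →* B := ∏ x ∈ hfin.toFinset, (ρ x).comp (ev x)
    have hΨ : ∀ z, Ψ z = ∏ x ∈ hfin.toFinset, ρ x (ev x z) := fun z =>
      MonoidHom.finsetProd_apply _ _ _
    have hΨc : Continuous Ψ := by
      refine Continuous.congr (continuous_finsetProd _ fun x _ =>
        ((ρ x).continuous_of_isOpen_ker (hρ x)).comp (hev x)) fun v => (hΨ v).symm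
    have hev1 : ∀ x, ev x (φ x) = Multiplicative.ofAdd 1 := fun x =>
      Pi.single_eq_same (M := fun _ : X => ℤ_[p]) x 1
    have hev0 : ∀ x y, x ≠ y → ev x (φ y) = 1 := fun x y hxy =>
      Pi.single_eq_of_ne (M := fun _ : X => ℤ_[p]) hxy 1
    have hagree : ∀ y, Ψ (φ y) = k (ι y) := fun y => by
      rw [hΨ]
      by_cases hy : y ∈ hfin.toFinset
      · rw [Finset.prod_eq_single_of_mem y hy fun x _ hxy => by rw [hev0 x y hxy, map_one],
          hev1, hρ1]
      · rw [Finset.prod_eq_one fun x hx => by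
          rw [hev0 x y (fun hxy => hy (hxy ▸ hx)), map_one]]
        by_contra h1
        exact hy (hfin.mem_toFinset.2 (Ne.symm h1))
    obtain ⟨F, -, hF⟩ := hu B hB (fun x => k (ι x)) hkι
    have h1 := hF ⟨k, hk⟩ fun x => rfl
    have h2 := hF ⟨Ψ.comp f.toMonoidHom, hΨc.comp f.continuous_toFun⟩ fun x => by
      change Ψ (f (ι x)) = _
      rw [hf, hagree]
    have h3 : Ψ (f g) = k g := DFunLike.congr_fun (h2.trans h1.symm) g
    have h4 : f g = 1 := (hff' g).symm.trans hx
    rw [h4, map_one, eq_comm] at h3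
    exact hW ((QuotientGroup.eq_one_iff _).1 h3) rfl
  let e : Additive (TopologicalAbelianization G) ≃+ (X → ℤ_[p]) :=
    AddEquiv.ofBijective (MonoidHom.toAdditiveLeft f') ⟨hinj, hsurj⟩
  have he : Continuous e := hf'
  have hcA : CompactSpace (Additive (TopologicalAbelianization G)) :=
    inferInstanceAs (CompactSpace (TopologicalAbelianization G))
  exact ⟨X, ⟨{ e with
    continuous_toFun := he
    continuous_invFun := he.continuous_symm_of_equiv_compact_to_t2 (f := e.toEquiv) }⟩⟩

/-- If homomorphisms to `𝔽_p` are transfers, then `Ver` is injective modulo `p`: an element of a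
product of copies of `ℤ_p` is divisible by `p` as soon as all its coordinates vanish modulo
`p`. -/
theorem LiftsAlongFiniteSurjections.exists_pow_of_ver_eq_pow (hG : IsProP p G)
    (h : LiftsAlongFiniteSurjections p G) (hfree : IsZpFree p (TopologicalAbelianization G))
    (V : OpenSubgroup G) (hV : V.toSubgroup.Normal) (x : TopologicalAbelianization G)
    (y : TopologicalAbelianization V.toSubgroup) (hxy : ver V x = y ^ p) :
    ∃ x', x = x' ^ p := by
  obtain ⟨I, ⟨e⟩⟩ := hfree
  have hdvd : ∀ i, (p : ℤ_[p]) ∣ e (Additive.ofMul x) i := by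
    intro i
    -- `𝔽_p`, in multiplicative notation and in the universe of `G`
    let C : Type u := ULift.{u} (Multiplicative (ZMod p))
    have hcard : Nat.card C = p := by
      rw [Nat.card_congr Equiv.ulift, Nat.card_congr Multiplicative.toAdd, Nat.card_zmod]
    have hC : IsPGroup p C := IsPGroup.of_card (n := 1) (by rw [hcard, pow_one])
    have : Finite C := Nat.finite_of_card_ne_zero (hcard ▸ (Fact.out : p.Prime).ne_zero)
    have hCp : ∀ b : C, b ^ p = 1 := fun b => by
      have := pow_card_eq_one' (x := b)
      rwa [hcard] at this
    let c : TopologicalAbelianization G →* Multiplicative ℤ_[p] :=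
      AddMonoidHom.toMultiplicativeRight ((Pi.evalAddMonoidHom (fun _ : I => ℤ_[p]) i).comp
        e.toAddEquiv.toAddMonoidHom)
    have hc : Continuous c := (continuous_apply i).comp e.continuous_toFun
    obtain ⟨ρ, hρ, hρ1⟩ := exists_padicInt_hom (p := p) (B := C) 1
      (ULift.up (Multiplicative.ofAdd 1)) (by rw [pow_one, hCp])
    let _ : TopologicalSpace C := ⊥
    have : DiscreteTopology C := ⟨rfl⟩
    have hρc := ρ.continuous_of_isOpen_ker hρ
    let τ : G →* C := (ρ.comp c).comp (QuotientGroup.mk' _)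
    have hτ : Continuous τ := (hρc.comp hc).comp continuous_quotient_mk'
    obtain ⟨χ, hχ, hχτ⟩ := h.exists_transfer_eq hG V hC τ (τ.isOpen_ker hτ)
    obtain ⟨χ', -, hχχ'⟩ := TopologicalAbelianization.exists_lift χ (χ.continuous_of_isOpen_ker hχ)
    obtain ⟨g, rfl⟩ := QuotientGroup.mk_surjective x
    have h1 : χ = χ'.comp (QuotientGroup.mk' (commutator V.toSubgroup).topologicalClosure) := by
      ext v
      rw [MonoidHom.comp_apply, QuotientGroup.mk'_apply, hχχ']
    have h2 : τ g = 1 := by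
      rw [← hχτ, h1, MonoidHom.transfer_comp, ← ver_mk, hxy, map_pow, hCp]
    have h3 : ρ (c (QuotientGroup.mk g)) = 1 := h2
    let z : ℤ_[p] := e (Additive.ofMul (QuotientGroup.mk g)) i
    obtain ⟨w, hw⟩ := (PadicInt.norm_lt_one_iff_dvd _).1 (PadicInt.mem_nonunits.1
      ((IsLocalRing.mem_maximalIdeal _).1 (PadicInt.sub_zmodRepr_mem z)))
    have hz : c (QuotientGroup.mk g) =
        Multiplicative.ofAdd 1 ^ PadicInt.zmodRepr z * Multiplicative.ofAdd w ^ p := by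
      change z = PadicInt.zmodRepr z • 1 + p • w
      rw [nsmul_eq_mul, nsmul_eq_mul, mul_one, ← hw, add_sub_cancel]
    rw [hz, map_mul, map_pow, map_pow, hCp, mul_one, hρ1] at h3
    have h4 : PadicInt.zmodRepr z • (1 : ZMod p) = 0 := congrArg (fun b : C => b.down.toAdd) h3
    rw [nsmul_eq_mul, mul_one, ZMod.natCast_eq_zero_iff] at h4
    have h5 := dvd_add (Nat.cast_dvd_cast (α := ℤ_[p]) h4) (Dvd.intro w hw.symm)
    rwa [add_sub_cancel] at h5
  choose w hw using hdvd
  refine ⟨(e.symm w).toMul, ?_⟩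
  change Additive.ofMul x = p • e.symm w
  rw [← map_nsmul, ← e.apply_eq_iff_eq, e.apply_symm_apply]
  funext i
  rw [hw, Pi.smul_apply, nsmul_eq_mul]

theorem IsFreeProP.isZpFree_and_injective (hG : IsProP p G) (h : IsFreeProP p G)
    (U : OpenSubgroup G) : IsZpFree p (TopologicalAbelianization U.toSubgroup) ∧
      ∀ V : OpenSubgroup U.toSubgroup, V.toSubgroup.Normal →
        Function.Injective (verTensor p V) := by
  have key : ∀ (H : Type u) [Group H] [TopologicalSpace H] [IsTopologicalGroup H] [CompactSpace H]
      [TotallyDisconnectedSpace H], IsProP p H → LiftsAlongFiniteSurjections p H →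
      ∀ W : OpenSubgroup H, IsProP p W.toSubgroup ∧ LiftsAlongFiniteSurjections p W.toSubgroup ∧
        IsZpFree p (TopologicalAbelianization W.toSubgroup) := by
    intro H _ _ _ _ _ hH hL W
    have h1 : IsProP p W.toSubgroup :=
      hH.of_isInducing W.toSubgroup.subtype .subtypeVal
    have h2 := hL.openSubgroup hH W
    exact ⟨h1, h2, IsFreeProP.isZpFree h1
      (isFreeProP_of_centralExtensionsSplit h1 h2.centralExtensionsSplit)⟩
  obtain ⟨hU, hUL, hUZ⟩ := key G hG h.liftsAlongFiniteSurjections U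
  refine ⟨hUZ, fun V hV => ?_⟩
  obtain ⟨-, -, J, ⟨e⟩⟩ := key U.toSubgroup hU hUL V
  refine rTensor_injective_of_forall_nsmul e.toAddEquiv _ fun a b hab => ?_
  exact hUL.exists_pow_of_ver_eq_pow hU hUZ V hV a.toMul b.toMul hab

end

/-! ### Characterization of free pro-`p` groups by abelianizations and transfers -/

theorem mainTheorem5 (p : ℕ) [Fact p.Prime] (G : Type u) [Group G] [TopologicalSpace G]
    [IsTopologicalGroup G] [CompactSpace G] [TotallyDisconnectedSpace G] [Nontrivial G]
    (hG : IsProP p G) :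
    IsFreeProP p G ↔
      (∀ U : OpenNormalSubgroup G, IsZpFree p (TopologicalAbelianization U.toSubgroup)) ∧
      (∀ (U : OpenSubgroup G) (V : OpenSubgroup U.toSubgroup), V.toSubgroup.Normal →
        Function.Injective (verTensor p V)) :=
  ⟨fun h => ⟨fun U => (h.isZpFree_and_injective hG U.toOpenSubgroup).1,
      fun U V hV => (h.isZpFree_and_injective hG U).2 V hV⟩,
    fun h => isFreeProP_of_centralExtensionsSplit hG
      (centralExtensionsSplit_of_isZpFree hG h.1 h.2)⟩
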